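/- **Definitions.** Let $Q$ be a finite set. Write $\mathbf v\preceq_0\mathbf w$ for $\mathbf v,\mathbf w\in\mathbb N^E$ ($E$ a finite set) if $\mathbf v\le\mathbf w$ componentwise and $\mathbf v,\mathbf w$ have the same support $\{e : \mathbf v(e)\ge 1\}$. For a multiset of transitions $D\in\mathbb N^{Q\times Q}$ let $\mathrm{pre}(D)(p)=\sum_{q}D(p,q)$ and $\mathrm{post}(D)(q)=\sum_{p}D(p,q)$. A *transition counter system* $\mathcal S$ (without controller) consists of a finite set $Q$ of states, a set $Q_0\subseteq Q$ of initial states and a (possibly infinite) set $\mathcal D\subseteq\mathbb N^{Q\times Q}$. Its configurations are the $\mathbf v\in\mathbb N^Q$, and there is a step $\mathbf v\to\mathbf v'$ based on $D\in\mathcal D$ iff $\mathrm{pre}(D)\le\mathbf v$ and $\mathbf v'=\mathbf v-\mathrm{pre}(D)+\mathrm{post}(D)$ (so processes that take no transition stay where they are). A configuration is initial if it is $0$ outside $Q_0$, and reachable if finitely many steps (possibly none) lead to it from an initial configuration. Let $D_{\min}$ be the (finite) set of $\preceq_0$-minimal elements of $\mathcal D$. $\mathcal S$ is *$\preceq_0$-compatible*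 if (forward) whenever $\mathbf v\to\mathbf v'$ and $\mathbf v\preceq_0\mathbf w$ there is a step $\mathbf w\to\mathbf w'$ with $\mathbf v'\preceq_0\mathbf w'$, and (backward) whenever $\mathbf v\to\mathbf v'$ and $\mathbf v'\preceq_0\mathbf w'$ there is a step $\mathbf w\to\mathbf w'$ with $\mathbf v\preceq_0\mathbf w$. $CC[\ge a]$ is the class of formulas $\varphi ::= \#q\ge a \mid \varphi\wedge\varphi\mid\varphi\vee\varphi$ with $q\in Q$, $a\in\mathbb N$, where $\mathbf v\models \#q\ge a$ iff $\mathbf v(q)\ge a$; $\varphi_\alpha$ is obtained from $\varphi$ by replacing each atom $\#q\ge a$ with $a\ge1$ by $\#q\ge1$. The *cardinality reachability problem (CRP)* asks, given $\mathcal S$ and $\varphi$, whether some reachable configuration of $\mathcal S$ satisfies $\varphi$. An input lists $Q$ (as $\{0,\dots,n-1\}$), $Q_0$, the elements of $D_{\min}$ (each as a list of transitions with multiplicities), and $\varphi$, with all numbers in binary. For $\mathbf v\in\mathbb N^Q$ let $\alpha(\mathbf v)\in\{0,1\}^Q$ be the indicator vector of its support; there is an abstract step $s\to s'$ in $\{0,1\}^Q$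 based on $D$ iff $s=\alpha(\mathbf v)$ and $s'=\alpha(\mathbf v')$ for some step $\mathbf v\to\mathbf v'$ based on $D$. A *saturation* of $\mathcal S$ is any $s\in\{0,1\}^Q$ obtained by starting from the indicator vector of $Q_0$ and repeatedly taking abstract steps $s\to s'$ based on elements of $D_{\min}$ with $s\le s'$ and $s\ne s'$, until no such step is possible. **Theorem.** The CRP for $\preceq_0$-compatible transition counter systems and $\varphi\in CC[\ge a]$ is decidable in polynomial time: there is a Turing machine that, on every input, halts with answer yes or no within a number of steps polynomial in the length of the input (which comprises $n$, $Q_0$, $D_{\min}$ and $\varphi$), and that, for every $\preceq_0$-compatible transition counter system $\mathcal S$ with state set $\{0,\dots,n-1\}$ and every $\varphi\in CC[\ge a]$, answers yes on each input describing $(\mathcal S,\varphi)$ iff some reachable configuration of $\mathcal S$ satisfies $\varphi$. Moreover the answer is the one given by saturation: a saturation of $\mathcal S$ exists, and for every saturation $s$ of $\mathcal S$ the answer is yes iff $s\models\varphi_\alpha$. -/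

import Mathlib

/-- A configuration: the controller state, and the number of user processes in each user state. -/
abbrev Config (C Q : Type) : Type := C × (Q → ℕ)

/-- A counter system with finite controller state set `C` and finite user state set `Q`,
together with its initial states. Steps preserve the number of processes. -/
structure CounterSystem (C Q : Type) [Fintype C] [Fintype Q] where
  Step : Config C Q → Config C Q → Prop
  size_eq : ∀ x y, Step x y → ∑ q, x.2 q = ∑ q, y.2 q
  ctrlInit : C
  userInit : Set Q

namespace CounterSystem

variable {C Q : Type} [Fintype C] [Fintype Q]

/-- Initial configurations: any number of user processes, all of them in initial states. -/
def IsInitial (S : CounterSystem C Q) (x : Config C Q) : Prop :=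
  x.1 = S.ctrlInit ∧ ∀ q, q ∉ S.userInit → x.2 q = 0

def Reachable (S : CounterSystem C Q) (y : Config C Q) : Prop :=
  ∃ x, S.IsInitial x ∧ Relation.ReflTransGen S.Step x y

def ForwardCompatible (S : CounterSystem C Q) (r : Config C Q → Config C Q → Prop) : Prop :=
  ∀ x x' y, S.Step x x' → r x y → ∃ y', S.Step y y' ∧ r x' y'

def BackwardCompatible (S : CounterSystem C Q) (r : Config C Q → Config C Q → Prop) : Prop :=
  ∀ x x' y', S.Step x x' → r x' y' → ∃ y, S.Step y y' ∧ r x y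

def FullyCompatible (S : CounterSystem C Q) (r : Config C Q → Config C Q → Prop) : Prop :=
  S.ForwardCompatible r ∧ S.BackwardCompatible r

end CounterSystem

/-- The order `≼₀` on multisets: componentwise order, and the same support. -/
def MultisetLe₀ {E : Type} (v w : E → ℕ) : Prop :=
  (∀ e, v e ≤ w e) ∧ ∀ e, v e = 0 ↔ w e = 0

/-- The well-quasi-order `≼₀` on configurations. -/
def ConfigLe₀ {C Q : Type} (x y : Config C Q) : Prop :=
  x.1 = y.1 ∧ MultisetLe₀ x.2 y.2

/-- The `01`-abstraction of a vector of counters: which states are occupied. -/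
def abs01 {Q : Type} (v : Q → ℕ) : Q → Bool := fun q => decide (1 ≤ v q)

/-- A multiset of local transitions `(p, q)`, each of which moves one user process from `p` to
`q`, given by the multiplicity of each transition. -/
abbrev TransMultiset (Q : Type) : Type := Q × Q → ℕ

namespace TransMultiset

variable {Q : Type} [Fintype Q]

/-- The multiset of source states. -/
def pre (D : TransMultiset Q) : Q → ℕ := fun p => ∑ q, D (p, q)

/-- The multiset of target states. -/
def post (D : TransMultiset Q) : Q → ℕ := fun q => ∑ p, D (p, q)

/-- `v → v - pre D + post D`, enabled when `pre D ≤ v`; the other processes do not move. -/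
def Fires (D : TransMultiset Q) (v v' : Q → ℕ) : Prop :=
  (∀ q, D.pre q ≤ v q) ∧ ∀ q, v' q = v q - D.pre q + D.post q

/-- The steps of the `01`-abstraction that come from firing `D`. -/
def AbsFires (D : TransMultiset Q) (s s' : Q → Bool) : Prop :=
  ∃ v v', D.Fires v v' ∧ abs01 v = s ∧ abs01 v' = s'

theorem Fires.sum_eq {D : TransMultiset Q} {v v' : Q → ℕ} (h : D.Fires v v') :
    ∑ q, v q = ∑ q, v' q := by
  have h1 : ∑ q, D.pre q = ∑ q, D.post q := Finset.sum_comm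
  have h2 : ∑ q, (v' q + D.pre q) = ∑ q, (v q + D.post q) := by
    refine Finset.sum_congr rfl fun q _ => ?_
    have := h.1 q
    have := h.2 q
    omega
  rw [Finset.sum_add_distrib, Finset.sum_add_distrib] at h2
  omega

end TransMultiset

/-- A transition counter system: there is no controller, and the steps are those that fire one of
the multisets of transitions in a (possibly infinite) set `steps`. -/
structure TransitionCounterSystem (Q : Type) where
  steps : Set (TransMultiset Q)
  init : Set Q

namespace TransitionCounterSystem

variable {Q : Type} [Fintype Q]

/-- The underlying counter system; "no controller" means that the controller has one state. -/
def toCounterSystem (S : TransitionCounterSystem Q) : CounterSystem Unit Q where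
  Step x y := ∃ D ∈ S.steps, D.Fires x.2 y.2
  size_eq := fun _ _ ⟨_, _, h⟩ => h.sum_eq
  ctrlInit := ()
  userInit := S.init

/-- The `≼₀`-minimal multisets of transitions of the system. -/
def minimalSteps (S : TransitionCounterSystem Q) : Set (TransMultiset Q) :=
  {D | D ∈ S.steps ∧ ∀ D' ∈ S.steps, MultisetLe₀ D' D → D' = D}

/-- There are finitely many minimal multisets, so every system can be described by an input. -/
theorem minimalSteps_finite (S : TransitionCounterSystem Q) : S.minimalSteps.Finite := by
  classical
  have h : S.minimalSteps =
      ⋃ F : Finset (Q × Q), {D ∈ S.minimalSteps | ∀ t, D t = 0 ↔ t ∈ F} := by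
    ext D
    constructor
    · intro h
      exact Set.mem_iUnion.2 ⟨Finset.univ.filter (fun t => D t = 0), h, by simp⟩
    · intro h
      obtain ⟨F, h, _⟩ := Set.mem_iUnion.1 h
      exact h
  rw [h]
  refine Set.finite_iUnion fun F => ?_
  refine IsAntichain.finite_of_partiallyWellOrderedOn (r := (· ≤ ·)) ?_
    (Set.isPWO_of_wellQuasiOrderedLE _)
  intro D hD D' hD' hne hle
  exact hne (hD'.1.2 D hD.1.1 ⟨fun t => hle t, fun t => by rw [hD.2, hD'.2]⟩)

/-- One step of the saturation: a `01`-step by a minimal multiset of transitions that keeps all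
occupied states occupied, and occupies at least one new state. -/
def GrowStep (S : TransitionCounterSystem Q) (s s' : Q → Bool) : Prop :=
  (∃ D ∈ S.minimalSteps, D.AbsFires s s') ∧
    (∀ q, s q = true → s' q = true) ∧ ∃ q, s' q = true ∧ s q = false

open Classical in
/-- `s` is a possible result of the saturation: start with exactly the initial states occupied,
and take growing steps until there are none left. -/
def IsSaturation (S : TransitionCounterSystem Q) (s : Q → Bool) : Prop :=
  Relation.ReflTransGen S.GrowStep (fun q => decide (q ∈ S.init)) s ∧ ∀ s', ¬ S.GrowStep s s'

end TransitionCounterSystem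

/-- The class `CC[≥ a]` of cardinality constraints: positive Boolean combinations of the atoms
`#q ≥ a`. -/
inductive GeConstraint (Q : Type) : Type
  | geq (q : Q) (a : ℕ) : GeConstraint Q
  | and (φ ψ : GeConstraint Q) : GeConstraint Q
  | or (φ ψ : GeConstraint Q) : GeConstraint Q

namespace GeConstraint

variable {Q : Type}

def Sat (v : Q → ℕ) : GeConstraint Q → Prop
  | geq q a => a ≤ v q
  | and φ ψ => φ.Sat v ∧ ψ.Sat v
  | or φ ψ => φ.Sat v ∨ ψ.Sat v

/-- `φ_α`: every atom `#q ≥ a` with `a` positive is replaced by `#q ≥ 1`. -/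
def abstr : GeConstraint Q → GeConstraint Q
  | geq q a => geq q (if a = 0 then 0 else 1)
  | and φ ψ => and φ.abstr ψ.abstr
  | or φ ψ => or φ.abstr ψ.abstr

end GeConstraint

/-- The cardinality reachability problem: is a configuration that satisfies `φ` reachable? -/
def CounterSystem.CRP {C Q : Type} [Fintype C] [Fintype Q] (S : CounterSystem C Q)
    (φ : GeConstraint Q) : Prop :=
  ∃ x, S.Reachable x ∧ φ.Sat x.2

/-- The input alphabet: binary digits, the end marker of a number, brackets, and the symbols of
constraints. -/
inductive CRPSymbol : Type
  | bit (b : Bool)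
  | endNum
  | bra
  | ket
  | geq
  | and
  | or
  deriving DecidableEq, Fintype

/-- A number in binary notation, followed by an end marker. -/
def encodeNumber (n : ℕ) : List CRPSymbol :=
  (Computability.encodeNat n).map CRPSymbol.bit ++ [CRPSymbol.endNum]

/-- Constraints in prefix notation. -/
def GeConstraint.encode {n : ℕ} : GeConstraint (Fin n) → List CRPSymbol
  | geq q a => CRPSymbol.geq :: (encodeNumber q.val ++ encodeNumber a)
  | and φ ψ => CRPSymbol.and :: (φ.encode ++ ψ.encode)
  | or φ ψ => CRPSymbol.or :: (φ.encode ++ ψ.encode)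

/-- A finite list of transitions with multiplicities. -/
abbrev StepList (n : ℕ) : Type := List ((Fin n × Fin n) × ℕ)

/-- The multiset of transitions given by a list. -/
def StepList.toTransMultiset {n : ℕ} (L : StepList n) : TransMultiset (Fin n) :=
  fun t => ((L.filter fun e => e.1 = t).map fun e => e.2).sum

def StepList.encode {n : ℕ} (L : StepList n) : List CRPSymbol :=
  CRPSymbol.bra ::
    ((L.flatMap fun e => encodeNumber e.1.1.val ++ encodeNumber e.1.2.val ++ encodeNumber e.2) ++
      [CRPSymbol.ket])

/-- An input of the problem, for systems with the state set `Fin n`: the initial states, the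
minimal multisets of transitions, and the constraint. -/
structure CRPInstance : Type where
  n : ℕ
  init : List (Fin n)
  steps : List (StepList n)
  φ : GeConstraint (Fin n)

namespace CRPInstance

/-- `I` describes `S`: the lists of `I` enumerate the initial states and the minimal multisets of
transitions of `S`, in any order. -/
def Describes (I : CRPInstance) (S : TransitionCounterSystem (Fin I.n)) : Prop :=
  (∀ q, q ∈ S.init ↔ q ∈ I.init) ∧
    ∀ D, D ∈ S.minimalSteps ↔ ∃ L ∈ I.steps, L.toTransMultiset = D

/-- The input as a string; its length is the size of the input. -/
def encode (I : CRPInstance) : List CRPSymbol :=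
  encodeNumber I.n ++
    (CRPSymbol.bra :: ((I.init.flatMap fun q : Fin I.n => encodeNumber q.val) ++ [CRPSymbol.ket])) ++
    (CRPSymbol.bra :: ((I.steps.flatMap fun L => L.encode) ++ [CRPSymbol.ket])) ++
    I.φ.encode

end CRPInstance

/-!
A saturation `s` is the least set of states that contains the initial states and is closed under
the minimal multisets of transitions: if it contains their sources, it contains their targets.
It is closed because firing with enough processes everywhere never empties a state
(`TransMultiset.absFires_union`), so that a target outside `s` would allow another growing step.

Every reachable configuration occupies only states of `s`, since a step can be replaced by a
minimal one with the same sources and targets (`IsSaturation.occupied_of_reachable`). Conversely,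
compatibility lifts each growing step to a step between reachable configurations with as many
processes as desired in every occupied state (`exists_reachable_ge`). As the constraints are
monotone, a reachable configuration satisfies `φ` iff `s` satisfies `φ_α`
(`IsSaturation.crp_iff`).

To find `s`, the algorithm keeps a list of known states and tries all steps in rounds. Until the
list is closed, each round enables a new step, so that more rounds than there are steps suffice
(`KnownList.closed_iterate_round`). The algorithm is carried out by an explicit machine with ten
stacks over the input alphabet and one output stack. It looks a state up by comparing its binary
representation with each entry of the list. A step adds at most its own length to the list in
each round, so the list has at most quadratic length and the running time is bounded by a
polynomial (`CRPMachine.runs_program`).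
-/

/-! ### Constraints and their abstraction -/

namespace GeConstraint

variable {Q : Type}

theorem Sat.abstr {φ : GeConstraint Q} {v : Q → ℕ} {s : Q → Bool} (h : φ.Sat v)
    (hs : ∀ q, v q ≠ 0 → s q = true) : φ.abstr.Sat (fun q => (s q).toNat) := by
  induction φ with
  | geq q a =>
    simp only [Sat, GeConstraint.abstr] at h ⊢
    split_ifs with ha
    · exact Nat.zero_le _
    · simp [hs q (by omega)]
  | and φ ψ ih₁ ih₂ => exact ⟨ih₁ h.1, ih₂ h.2⟩
  | or φ ψ ih₁ ih₂ => exact h.imp ih₁ ih₂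

/-- Counters that exceed every constant of `φ` on the occupied states cannot be distinguished by
`φ` from the abstraction. -/
theorem exists_bound_sat (φ : GeConstraint Q) :
    ∃ k, ∀ (v : Q → ℕ) (s : Q → Bool), (∀ q, s q = true → k ≤ v q) →
      φ.abstr.Sat (fun q => (s q).toNat) → φ.Sat v := by
  induction φ with
  | geq q a =>
    refine ⟨a, fun v s hk h => ?_⟩
    simp only [Sat, GeConstraint.abstr] at h ⊢
    split_ifs at h with ha
    · omega
    · exact hk q (by cases hq : s q <;> simp_all)
  | and φ ψ ih₁ ih₂ =>
    obtain ⟨k₁, h₁⟩ := ih₁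
    obtain ⟨k₂, h₂⟩ := ih₂
    exact ⟨max k₁ k₂, fun v s hk h =>
      ⟨h₁ v s (fun q hq => (le_max_left _ _).trans (hk q hq)) h.1,
        h₂ v s (fun q hq => (le_max_right _ _).trans (hk q hq)) h.2⟩⟩
  | or φ ψ ih₁ ih₂ =>
    obtain ⟨k₁, h₁⟩ := ih₁
    obtain ⟨k₂, h₂⟩ := ih₂
    exact ⟨max k₁ k₂, fun v s hk h =>
      h.imp (h₁ v s fun q hq => (le_max_left _ _).trans (hk q hq))
        (h₂ v s fun q hq => (le_max_right _ _).trans (hk q hq))⟩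

end GeConstraint

/-! ### Firing multisets of transitions -/

namespace TransMultiset

variable {Q : Type} [Fintype Q] {D : TransMultiset Q}

theorem pre_ne_zero_iff {p : Q} : D.pre p ≠ 0 ↔ ∃ q, D (p, q) ≠ 0 := by
  simp [pre, Finset.sum_eq_zero_iff]

theorem post_ne_zero_iff {q : Q} : D.post q ≠ 0 ↔ ∃ p, D (p, q) ≠ 0 := by
  simp [post, Finset.sum_eq_zero_iff]

theorem AbsFires.pre_subset {s s' : Q → Bool} (h : D.AbsFires s s') {q : Q}
    (hq : D.pre q ≠ 0) : s q = true := by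
  obtain ⟨v, v', hf, rfl, rfl⟩ := h
  have := hf.1 q
  simp only [abs01, decide_eq_true_eq]
  omega

theorem AbsFires.subset_post {s s' : Q → Bool} (h : D.AbsFires s s') {q : Q}
    (hq : s' q = true) : s q = true ∨ D.post q ≠ 0 := by
  obtain ⟨v, v', hf, rfl, rfl⟩ := h
  have := hf.2 q
  simp only [abs01, decide_eq_true_eq] at hq ⊢
  omega

/-- With enough processes in every occupied state, firing `D` empties no state. -/
theorem absFires_union (s : Q → Bool) (h : ∀ q, D.pre q ≠ 0 → s q = true) :
    D.AbsFires s (fun q => s q || decide (D.post q ≠ 0)) := by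
  refine ⟨fun q => if s q then D.pre q + 1 else 0,
    fun q => (if s q then D.pre q + 1 else 0) - D.pre q + D.post q, ⟨fun q => ?_, fun q => rfl⟩,
    ?_, ?_⟩
  · have := h q
    dsimp only
    split_ifs with hs
    · omega
    · by_contra hne
      exact hs (this (by omega))
  · funext q
    cases hs : s q <;> simp [abs01, hs]
  · funext q
    have := h q
    cases hs : s q
    · simp [abs01, hs, Nat.one_le_iff_ne_zero]
    · simp [abs01, hs]

end TransMultiset

/-! ### Saturation and reachability -/

namespace TransitionCounterSystem

variable {Q : Type} [Fintype Q] {S : TransitionCounterSystem Q}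

theorem exists_minimalSteps_le {D : TransMultiset Q} (hD : D ∈ S.steps) :
    ∃ D₀ ∈ S.minimalSteps, MultisetLe₀ D₀ D := by
  obtain ⟨D₀, ⟨h₀, hle⟩, hmin⟩ := (measure fun D : TransMultiset Q => ∑ t, D t).wf.has_min
    {D' | D' ∈ S.steps ∧ MultisetLe₀ D' D} ⟨D, hD, fun _ => le_rfl, fun _ => Iff.rfl⟩
  refine ⟨D₀, ⟨h₀, fun D' hD' hle' => ?_⟩, hle⟩
  have hnot := hmin D' ⟨hD', fun t => (hle'.1 t).trans (hle.1 t),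
    fun t => (hle'.2 t).trans (hle.2 t)⟩
  have hsum : ∑ t, D' t = ∑ t, D₀ t :=
    le_antisymm (Finset.sum_le_sum fun t _ => hle'.1 t) (not_lt.1 hnot)
  funext t
  exact (Finset.sum_eq_sum_iff_of_le fun t _ => hle'.1 t).1 hsum t (Finset.mem_univ t)

/-- A set of states that contains the targets of each minimal multiset of transitions whose
sources it contains. -/
def StepClosed (S : TransitionCounterSystem Q) (X : Set Q) : Prop :=
  ∀ D ∈ S.minimalSteps, (∀ q, D.pre q ≠ 0 → q ∈ X) → ∀ q, D.post q ≠ 0 → q ∈ X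

theorem IsSaturation.stepClosed {s : Q → Bool} (h : S.IsSaturation s) :
    S.StepClosed {q | s q = true} := by
  intro D hD hpre q hq
  by_contra hs
  refine h.2 _ ⟨⟨D, hD, TransMultiset.absFires_union s hpre⟩, fun q hq => by simp [hq], q, ?_, ?_⟩
  · simp [hq]
  · simpa using hs

theorem IsSaturation.init_subset {s : Q → Bool} (h : S.IsSaturation s) {q : Q}
    (hq : q ∈ S.init) : s q = true := by
  have := h.1
  clear h
  induction this with
  | refl => simpa using hq
  | tail _ hstep ih => exact hstep.2.1 q ih

theorem IsSaturation.subset_of_stepClosed {s : Q → Bool} (h : S.IsSaturation s) {X : Set Q}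
    (hinit : S.init ⊆ X) (hX : S.StepClosed X) {q : Q} (hq : s q = true) : q ∈ X := by
  have := h.1
  clear h
  induction this generalizing q with
  | refl => exact hinit (by simpa using hq)
  | tail _ hstep ih =>
    obtain ⟨⟨D, hD, hf⟩, -⟩ := hstep
    rcases hf.subset_post hq with h | h
    · exact ih h
    · exact hX D hD (fun q hq => ih (hf.pre_subset hq)) q h

theorem exists_isSaturation (S : TransitionCounterSystem Q) : ∃ s, S.IsSaturation s := by
  classical
  -- Growing steps decrease the number of empty states.
  obtain ⟨s, hs, hmin⟩ := (measure fun s : Q → Bool =>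
    (Finset.univ.filter fun q => s q = false).card).wf.has_min
    {s | Relation.ReflTransGen S.GrowStep (fun q => decide (q ∈ S.init)) s} ⟨_, .refl⟩
  refine ⟨s, hs, fun s' hstep => hmin s' (hs.tail hstep) (Finset.card_lt_card ?_)⟩
  obtain ⟨-, hle, q, hq', hq⟩ := hstep
  refine Finset.ssubset_iff_of_subset (fun p hp => ?_) |>.2 ⟨q, by simp [hq], by simp [hq']⟩
  have := hle p
  cases hp' : s p <;> simp_all

/-- No compatibility is needed to bound the reachable configurations by a saturation: a step can
be replaced by a minimal one with the same sources and targets. -/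
theorem IsSaturation.occupied_of_reachable {s : Q → Bool} (h : S.IsSaturation s)
    {x : Config Unit Q} (hx : S.toCounterSystem.Reachable x) {q : Q} (hq : x.2 q ≠ 0) :
    s q = true := by
  obtain ⟨x₀, hx₀, hsteps⟩ := hx
  induction hsteps generalizing q with
  | refl =>
    refine h.init_subset ?_
    by_contra hne
    exact hq (hx₀.2 q hne)
  | @tail y z _ hstep ih =>
    obtain ⟨D, hD, hf⟩ := hstep
    obtain ⟨D₀, hD₀, hle⟩ := exists_minimalSteps_le hD
    by_cases hy : y.2 q = 0
    · have h2 := hf.2 q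
      obtain ⟨p, hp⟩ := TransMultiset.post_ne_zero_iff.1 (show D.post q ≠ 0 by omega)
      refine h.stepClosed D₀ hD₀ (fun r hr => ih ?_) q
        (TransMultiset.post_ne_zero_iff.2 ⟨p, fun h0 => hp ((hle.2 _).1 h0)⟩)
      obtain ⟨t, ht⟩ := TransMultiset.pre_ne_zero_iff.1 hr
      have h1 := hf.1 r
      have : D.pre r ≠ 0 := TransMultiset.pre_ne_zero_iff.2 ⟨t, fun h0 => ht ((hle.2 _).2 h0)⟩
      omega
    · exact ih hy

/-- Compatibility makes every abstract run realizable by arbitrarily many processes: a step that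
realizes the abstract one is first enlarged by backward compatibility, and its source is then
matched with a reachable configuration by forward compatibility. -/
theorem exists_reachable_ge (hS : S.toCounterSystem.FullyCompatible ConfigLe₀) {s : Q → Bool}
    (hs : Relation.ReflTransGen S.GrowStep
      (open Classical in fun q => decide (q ∈ S.init)) s) (v : Q → ℕ) (hv : abs01 v = s) :
    ∃ w, S.toCounterSystem.Reachable w ∧ MultisetLe₀ v w.2 := by
  induction hs generalizing v with
  | refl =>
    refine ⟨((), v), ⟨_, ⟨rfl, fun q hq => ?_⟩, .refl⟩, fun _ => le_rfl, fun _ => Iff.rfl⟩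
    have := congrFun hv q
    simp only [abs01] at this
    by_contra hne
    rw [decide_eq_decide] at this
    exact hq (this.1 (Nat.one_le_iff_ne_zero.2 hne))
  | tail _ hstep ih =>
    obtain ⟨⟨D, hD, v₀, v₁, hf, rfl, rfl⟩, -⟩ := hstep
    have hsupp : ∀ {a b : Q → ℕ}, abs01 a = abs01 b → ∀ q, a q = 0 ↔ b q = 0 := by
      intro a b hab q
      have := congrFun hab q
      simp only [abs01, decide_eq_decide] at this
      omega
    -- `v₁ + v` lies above both `v₁` and `v`, which have the same support.
    obtain ⟨y, hy, -, hle⟩ := hS.2 ((), v₀) ((), v₁) ((), fun q => v₁ q + v q) ⟨D, hD.1, hf⟩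
      ⟨rfl, fun q => by simp, fun q => by have := hsupp hv q; simp only; omega⟩
    obtain ⟨w, ⟨x, hx, hxw⟩, hyw⟩ := ih y.2 (by
      funext q
      have := hle.2 q
      simp only [abs01, decide_eq_decide] at this ⊢
      omega)
    obtain ⟨w', hw', -, hle'⟩ := hS.1 y _ w hy ⟨rfl, hyw⟩
    refine ⟨w', ⟨x, hx, hxw.tail hw'⟩, fun q => ?_, fun q => ?_⟩
    · have := hle'.1 q
      simp only at this
      omega
    · have h1 := hsupp hv q
      have h2 := hle'.2 q
      simp only at h2
      omega

theorem IsSaturation.crp_iff (hS : S.toCounterSystem.FullyCompatible ConfigLe₀) {s : Q → Bool}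
    (h : S.IsSaturation s) (φ : GeConstraint Q) :
    S.toCounterSystem.CRP φ ↔ φ.abstr.Sat (fun q => (s q).toNat) := by
  constructor
  · rintro ⟨x, hx, hφ⟩
    exact hφ.abstr fun q hq => h.occupied_of_reachable hx hq
  · intro hφ
    obtain ⟨k, hk⟩ := φ.exists_bound_sat
    obtain ⟨w, hw, hle⟩ := exists_reachable_ge hS h.1 (fun q => if s q then k + 1 else 0) (by
      funext q
      cases hq : s q <;> simp [abs01, hq])
    refine ⟨w, hw, hk _ s (fun q hq => ?_) hφ⟩
    have := hle.1 q
    simp only [hq, if_true] at this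
    omega

end TransitionCounterSystem

/-! ### Computing the saturation in rounds -/

namespace StepList

variable {n : ℕ}

theorem toTransMultiset_ne_zero_iff {L : StepList n} {t : Fin n × Fin n} :
    L.toTransMultiset t ≠ 0 ↔ ∃ e ∈ L, e.1 = t ∧ e.2 ≠ 0 := by
  simp only [toTransMultiset, ne_eq, List.sum_eq_zero_iff, List.mem_map, List.mem_filter,
    decide_eq_true_eq]
  aesop

theorem pre_ne_zero_iff {L : StepList n} {p : Fin n} :
    L.toTransMultiset.pre p ≠ 0 ↔ ∃ e ∈ L, e.1.1 = p ∧ e.2 ≠ 0 := by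
  simp only [TransMultiset.pre_ne_zero_iff, toTransMultiset_ne_zero_iff]
  constructor
  · rintro ⟨q, e, he, h, h'⟩
    exact ⟨e, he, by rw [h], h'⟩
  · rintro ⟨e, he, rfl, h'⟩
    exact ⟨e.1.2, e, he, rfl, h'⟩

theorem post_ne_zero_iff {L : StepList n} {q : Fin n} :
    L.toTransMultiset.post q ≠ 0 ↔ ∃ e ∈ L, e.1.2 = q ∧ e.2 ≠ 0 := by
  simp only [TransMultiset.post_ne_zero_iff, toTransMultiset_ne_zero_iff]
  constructor
  · rintro ⟨p, e, he, h, h'⟩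
    exact ⟨e, he, by rw [h], h'⟩
  · rintro ⟨e, he, rfl, h'⟩
    exact ⟨e.1.1, e, he, rfl, h'⟩

end StepList

/-- The occupied states found so far. The flag tells whether an entry counts: the targets of the
transitions of multiplicity zero are listed with the flag `false`. -/
abbrev KnownList (n : ℕ) : Type := List (Bool × Fin n)

namespace KnownList

variable {n : ℕ}

/-- All sources of `L` are known to be occupied. -/
def enables (K : KnownList n) (L : StepList n) : Bool :=
  L.all fun e => decide (e.2 = 0) || decide ((true, e.1.1) ∈ K)

/-- The entries for the targets of `L`. -/
def targets (L : StepList n) : KnownList n :=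
  L.map fun e => (decide (e.2 ≠ 0), e.1.2)

/-- Try to fire `L`. -/
def fire (K : KnownList n) (L : StepList n) : KnownList n :=
  if K.enables L then targets L ++ K else K

/-- Try to fire each of the steps once, in order. -/
def round (steps : List (StepList n)) (K : KnownList n) : KnownList n :=
  steps.foldl fire K

/-- Nothing new can be obtained from the steps. -/
def Closed (steps : List (StepList n)) (K : KnownList n) : Prop :=
  ∀ L ∈ steps, K.enables L = true → ∀ e ∈ L, e.2 ≠ 0 → (true, e.1.2) ∈ K

theorem enables_iff {K : KnownList n} {L : StepList n} :
    K.enables L = true ↔ ∀ e ∈ L, e.2 ≠ 0 → (true, e.1.1) ∈ K := by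
  simp only [enables, List.all_eq_true, Bool.or_eq_true, decide_eq_true_eq]
  exact forall₂_congr fun e _ => or_iff_not_imp_left

theorem mem_targets {L : StepList n} {q : Fin n} :
    (true, q) ∈ targets L ↔ ∃ e ∈ L, e.2 ≠ 0 ∧ e.1.2 = q := by
  simp [targets]

theorem enables_mono {K K' : KnownList n} (h : ∀ q, (true, q) ∈ K → (true, q) ∈ K')
    {L : StepList n} (hL : K.enables L = true) : K'.enables L = true :=
  enables_iff.2 fun e he h0 => h _ (enables_iff.1 hL e he h0)

theorem subset_fire (K : KnownList n) (L : StepList n) : K ⊆ K.fire L := by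
  unfold fire
  split_ifs
  · exact List.subset_append_right _ _
  · exact List.Subset.refl _

theorem subset_round (steps : List (StepList n)) (K : KnownList n) : K ⊆ K.round steps := by
  induction steps generalizing K with
  | nil => exact List.Subset.refl _
  | cons L steps ih => exact List.Subset.trans (subset_fire K L) (ih _)

theorem mem_round_of_enables {steps : List (StepList n)} {K : KnownList n} {L : StepList n}
    (hL : L ∈ steps) (hK : K.enables L = true) {e : (Fin n × Fin n) × ℕ} (he : e ∈ L)
    (h0 : e.2 ≠ 0) : (true, e.1.2) ∈ K.round steps := by
  induction steps generalizing K with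
  | nil => simp at hL
  | cons L' steps ih =>
    rcases List.mem_cons.1 hL with rfl | hL
    · refine subset_round steps _ ?_
      rw [fire, if_pos hK]
      exact List.mem_append_left _ (mem_targets.2 ⟨e, he, h0, rfl⟩)
    · exact ih hL (enables_mono (fun q hq => subset_fire K L' hq) hK)

/-- Rounds stay inside every closed set of states. -/
theorem round_sound {X : Set (Fin n)} {steps : List (StepList n)}
    (hX : ∀ L ∈ steps, (∀ e ∈ L, e.2 ≠ 0 → e.1.1 ∈ X) → ∀ e ∈ L, e.2 ≠ 0 → e.1.2 ∈ X)
    {K : KnownList n} (hK : ∀ q, (true, q) ∈ K → q ∈ X) {q : Fin n}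
    (hq : (true, q) ∈ K.round steps) : q ∈ X := by
  induction steps generalizing K with
  | nil => exact hK q hq
  | cons L steps ih =>
    refine ih (fun L' hL' => hX L' (List.mem_cons_of_mem _ hL')) (fun p hp => ?_) hq
    unfold fire at hp
    split_ifs at hp with hen
    · rcases List.mem_append.1 hp with hp | hp
      · obtain ⟨e, he, h0, rfl⟩ := mem_targets.1 hp
        exact hX L List.mem_cons_self (fun e he h0 => hK _ (enables_iff.1 hen e he h0)) e he h0
      · exact hK p hp
    · exact hK p hp

theorem Closed.round {steps : List (StepList n)} {K : KnownList n} (h : Closed steps K) :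
    Closed steps (K.round steps) := by
  have hback : ∀ q, (true, q) ∈ K.round steps → (true, q) ∈ K := fun q hq =>
    round_sound (X := {q | (true, q) ∈ K}) (fun L hL hen => h L hL (enables_iff.2 hen))
      (fun _ hq => hq) hq
  exact fun L hL hen e he h0 => subset_round _ _ (h L hL (enables_mono hback hen) e he h0)

/-- A step that is enabled after a round without having been enabled before is new; if there is
none, then all enabled steps have been fired in the round. -/
theorem closed_round_of_countP_le {steps : List (StepList n)} {K : KnownList n}
    (h : steps.countP (K.round steps).enables ≤ steps.countP K.enables) :
    Closed steps (K.round steps) := by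
  have hsub : (steps.filter K.enables).Sublist (steps.filter (K.round steps).enables) :=
    List.monotone_filter_right _ fun L hL => enables_mono (fun q hq => subset_round _ _ hq) hL
  have heq := hsub.eq_of_length_le (by simpa [List.countP_eq_length_filter] using h)
  intro L hL hen e he h0
  have hmem : L ∈ steps.filter K.enables := heq ▸ List.mem_filter.2 ⟨hL, hen⟩
  exact mem_round_of_enables hL (List.mem_filter.1 hmem).2 he h0

/-- Until the set is closed, each round enables a new step; so there are at most as many such
rounds as there are steps. -/
theorem closed_iterate_round {steps : List (StepList n)} (K : KnownList n) {c : ℕ}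
    (hc : steps.length < c) : Closed steps ((round steps)^[c] K) := by
  have key : ∀ j, Closed steps ((round steps)^[j] K) ∨
      j ≤ steps.countP ((round steps)^[j] K).enables := by
    intro j
    induction j with
    | zero => exact Or.inr (Nat.zero_le _)
    | succ j ih =>
      rw [Function.iterate_succ_apply']
      rcases ih with h | h
      · exact Or.inl h.round
      · by_cases hle : steps.countP (round steps ((round steps)^[j] K)).enables ≤
            steps.countP ((round steps)^[j] K).enables
        · exact Or.inl (closed_round_of_countP_le hle)
        · exact Or.inr (by omega)
  rcases key c with h | h
  · exact h
  · have := List.countP_le_length (p := ((round steps)^[c] K).enables) (l := steps)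
    omega

theorem subset_iterate_round (steps : List (StepList n)) (K : KnownList n) (c : ℕ) :
    K ⊆ (round steps)^[c] K := by
  induction c generalizing K with
  | zero => exact List.Subset.refl _
  | succ c ih => exact List.Subset.trans (subset_round steps K) (ih _)

theorem iterate_round_sound {X : Set (Fin n)} {steps : List (StepList n)}
    (hX : ∀ L ∈ steps, (∀ e ∈ L, e.2 ≠ 0 → e.1.1 ∈ X) → ∀ e ∈ L, e.2 ≠ 0 → e.1.2 ∈ X)
    {K : KnownList n} (hK : ∀ q, (true, q) ∈ K → q ∈ X) (c : ℕ) {q : Fin n}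
    (hq : (true, q) ∈ (round steps)^[c] K) : q ∈ X := by
  induction c generalizing K with
  | zero => exact hK q hq
  | succ c ih => exact ih (fun q => round_sound hX hK) hq

end KnownList

/-- Evaluation of `φ_α` in the set of known states. -/
def GeConstraint.evalKnown {n : ℕ} (K : KnownList n) : GeConstraint (Fin n) → Bool
  | geq q a => decide ((true, q) ∈ K) || decide (a = 0)
  | and φ ψ => φ.evalKnown K && ψ.evalKnown K
  | or φ ψ => φ.evalKnown K || ψ.evalKnown K

theorem GeConstraint.evalKnown_iff {n : ℕ} {K : KnownList n} {s : Fin n → Bool}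
    (hs : ∀ q, s q = true ↔ (true, q) ∈ K) (φ : GeConstraint (Fin n)) :
    φ.evalKnown K = true ↔ φ.abstr.Sat (fun q => (s q).toNat) := by
  induction φ with
  | geq q a =>
    simp only [evalKnown, abstr, Sat, Bool.or_eq_true, decide_eq_true_eq, ← hs]
    by_cases ha : a = 0
    · simp [ha]
    · cases hq : s q <;> simp [ha]
  | and φ ψ ih₁ ih₂ => simp only [evalKnown, abstr, Sat, Bool.and_eq_true, ih₁, ih₂]
  | or φ ψ ih₁ ih₂ => simp only [evalKnown, abstr, Sat, Bool.or_eq_true, ih₁, ih₂]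

namespace CRPInstance

variable (I : CRPInstance)

/-- The initial states. -/
def initKnown : KnownList I.n := I.init.map fun q => (true, q)

/-- The steps of the system as they stand in the input, without the enclosing brackets. -/
def stepsString : List CRPSymbol := I.steps.flatMap fun L => L.encode

/-- The states found by the algorithm. Any number of rounds that exceeds the number of steps
would do; the length of a string gives such a number without any arithmetic. -/
def known : KnownList I.n :=
  (KnownList.round I.steps)^[I.stepsString.length + 1] I.initKnown

/-- The answer of the algorithm. -/
def decideCRP : Bool := I.φ.evalKnown I.known

theorem length_steps_le : I.steps.length ≤ I.stepsString.length := by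
  unfold stepsString
  generalize I.steps = steps
  induction steps with
  | nil => simp
  | cons L steps ih => simp [StepList.encode]; omega

variable {I}

theorem Describes.saturation_iff {S : TransitionCounterSystem (Fin I.n)} (h : I.Describes S)
    {s : Fin I.n → Bool} (hs : S.IsSaturation s) (q : Fin I.n) :
    s q = true ↔ (true, q) ∈ I.known := by
  have hmem : ∀ {L}, L ∈ I.steps → L.toTransMultiset ∈ S.minimalSteps :=
    fun hL => (h.2 _).2 ⟨_, hL, rfl⟩
  constructor
  · intro hq
    refine hs.subset_of_stepClosed (X := {q | (true, q) ∈ I.known}) (fun p hp => ?_)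
      (fun D hD hpre p hp => ?_) hq
    · refine KnownList.subset_iterate_round _ _ _ ?_
      simpa [initKnown] using (h.1 p).1 hp
    · obtain ⟨L, hL, rfl⟩ := (h.2 D).1 hD
      obtain ⟨e, he, rfl, h0⟩ := StepList.post_ne_zero_iff.1 hp
      refine KnownList.closed_iterate_round I.initKnown (Nat.lt_succ_of_le I.length_steps_le)
        L hL (KnownList.enables_iff.2 fun e he h0 => ?_) e he h0
      exact hpre _ (StepList.pre_ne_zero_iff.2 ⟨e, he, rfl, h0⟩)
  · refine KnownList.iterate_round_sound (X := {q | s q = true}) (fun L hL hpre e he h0 => ?_)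
      (fun p hp => ?_) _
    · refine hs.stepClosed _ (hmem hL) (fun p hp => ?_) _
        (StepList.post_ne_zero_iff.2 ⟨e, he, rfl, h0⟩)
      obtain ⟨e, he, rfl, h0⟩ := StepList.pre_ne_zero_iff.1 hp
      exact hpre e he h0
    · exact hs.init_subset ((h.1 p).2 (by simpa [initKnown] using hp))

theorem Describes.decideCRP_iff {S : TransitionCounterSystem (Fin I.n)} (h : I.Describes S)
    {s : Fin I.n → Bool} (hs : S.IsSaturation s) :
    I.decideCRP = true ↔ I.φ.abstr.Sat (fun q => (s q).toNat) :=
  GeConstraint.evalKnown_iff (h.saturation_iff hs) I.φ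

end CRPInstance

/-! ### The machine -/

namespace CRPMachine

open Turing.TM2 (Stmt)
open Turing.TM2.Stmt

/-- The stacks over the input alphabet. While a stack `x` is read, the symbols popped from it are
kept on the stack `xDone`, in reverse order. -/
inductive WorkStack : Type
  /-- The part of the input that has not been read. -/
  | input
  /-- The steps of the system. -/
  | steps
  | stepsDone
  /-- The number of remaining rounds, in unary. -/
  | counter
  /-- The targets of the step that is being read, in reverse order. -/
  | fresh
  /-- The list of known states. -/
  | known
  | knownDone
  /-- The number of the state that is searched for. -/
  | num
  | numDone
  /-- The constraint with its atoms replaced by their values, in reverse order. -/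
  | formula
  deriving DecidableEq

instance : Fintype WorkStack :=
  ⟨{.input, .steps, .stepsDone, .counter, .fresh, .known, .knownDone, .num, .numDone,
    .formula}, fun x => by cases x <;> decide⟩

/-- All stacks are work stacks, except for the output stack `none`, which contains booleans. -/
abbrev StackSymbol : Option WorkStack → Type
  | none => Bool
  | some _ => CRPSymbol

/-- What the machine is doing. The loops that are shared between the phases continue according to
it. -/
inductive Phase : Type
  | init
  | steps
  | formula
  deriving DecidableEq

instance : Fintype Phase :=
  ⟨{.init, .steps, .formula}, fun x => by cases x <;> decide⟩

/-- The finite memory of the machine: `found` is the result of the search for a state, `eq` tells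
whether the digits compared so far agree, `ok` whether the sources read so far are known, and
`pos` whether a number read digit by digit is positive. -/
structure Flags : Type where
  found : Bool := false
  eq : Bool := true
  ok : Bool := false
  pos : Bool := false
  phase : Phase := .init
  deriving Fintype

/-- The labels of the program. Most of them are loops that process one symbol in each step. -/
inductive Label : Type
  /-- Skip the number of states, which the algorithm does not need. -/
  | skipSize
  /-- Read the initial states. -/
  | readInit
  /-- Add the states on the stack `fresh` to the known states. -/
  | transfer
  /-- Copy the steps, outside of the brackets of a step. -/
  | copySteps
  /-- Copy the steps, inside the brackets of a step. -/
  | copyStep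
  /-- Go back to the first step, and start the next round unless all rounds are over. -/
  | rewind
  /-- Read a bracket, or the source of a transition. -/
  | readSource
  | readTarget
  | readMult
  /-- Drop the targets of a step that is not enabled. -/
  | discard
  /-- Bring the number searched for back into the right order. -/
  | reverse
  /-- Compare the number searched for with the known states. -/
  | compare
  /-- Erase the number after the search. -/
  | erase
  /-- Bring the list of known states back into the right order. -/
  | restore
  /-- Read the constraint, except for the constants `a` of the atoms `#q ≥ a`. -/
  | readFormula
  | readBound
  /-- Evaluate the constraint from right to left, with the output stack for the values. -/
  | evaluate
  | cleanSteps
  | cleanKnown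
  deriving DecidableEq

instance : Fintype Label :=
  ⟨{.skipSize, .readInit, .transfer, .copySteps, .copyStep, .rewind, .readSource,
    .readTarget, .readMult, .discard, .reverse, .compare, .erase, .restore, .readFormula,
    .readBound, .evaluate, .cleanSteps, .cleanKnown}, fun x => by cases x <;> decide⟩

/-- The first component is the symbol that was just popped; it is `none` between two steps. -/
abbrev Memory : Type := Option CRPSymbol × Flags

/-- The statements of the machine. -/
abbrev Code : Type := Stmt StackSymbol Label Memory

def setFlags (g : Flags → Flags) (q : Code) : Code := load (fun v => (v.1, g v.2)) q

def pushFlags (k : WorkStack) (g : Flags → CRPSymbol) (q : Code) : Code :=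
  push (some k) (fun v => g v.2) q

def pushSymbol (k : WorkStack) (x : CRPSymbol) (q : Code) : Code := pushFlags k (fun _ => x) q

def pushOutput (b : Bool) (q : Code) : Code := push none (fun _ => b) q

def ifFlags (g : Flags → Bool) (q q' : Code) : Code := branch (fun v => g v.2) q q'

def jump (l : Label) : Code := goto fun _ => l

/-- Choose `q` if `x` is the symbol that was popped, and forget that symbol. -/
def testSymbol (x : Option CRPSymbol) (q q' : Code) : Code :=
  branch (fun v => decide (v.1 = x)) (load (fun v => (none, v.2)) q) q'

/-- Pop a symbol, and continue with the code that `f` gives for it. -/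
def popCase (k : WorkStack) (f : Option CRPSymbol → Code) : Code :=
  pop (some k) (fun v x => (x, v.2)) <|
    testSymbol none (f none) <|
    testSymbol (some (.bit true)) (f (some (.bit true))) <|
    testSymbol (some (.bit false)) (f (some (.bit false))) <|
    testSymbol (some .endNum) (f (some .endNum)) <|
    testSymbol (some .bra) (f (some .bra)) <|
    testSymbol (some .ket) (f (some .ket)) <|
    testSymbol (some .geq) (f (some .geq)) <|
    testSymbol (some .and) (f (some .and)) <|
    testSymbol (some .or) (f (some .or)) halt

/-- Replace the two topmost values on the output stack by the value of `op`, with `found` as an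
auxiliary variable. -/
def applyBinary (op : Bool → Bool → Bool) (q : Code) : Code :=
  pop none (fun v x => (v.1, { v.2 with found := x == some true })) <|
  pop none (fun v x => (v.1, { v.2 with found := op v.2.found (x == some true) })) <|
  push none (fun v => v.2.found) <|
  setFlags (fun f => { f with found := false }) q

/-- The terminator of a listed state: only `endNum` makes the entry count. -/
def mark (b : Bool) : CRPSymbol := if b then .endNum else .ket

/-- The program. Numbers are read from the top of a stack, lowest digit first. -/
def program : Label → Code
  | .skipSize => popCase .input fun
    | some .bra => jump .readInit
    | _ => jump .skipSize
  | .readInit => popCase .input fun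
    | some .ket => jump .transfer
    | some x => pushSymbol .fresh x <| jump .readInit
    | none => halt
  | .transfer => popCase .fresh fun
    | some x => pushSymbol .known x <| jump .transfer
    | none => ifFlags (fun f => decide (f.phase = .init))
        (popCase .input fun _ => jump .copySteps) (jump .readSource)
  | .copySteps => popCase .input fun
    | some .bra => pushSymbol .stepsDone .bra <| pushSymbol .counter .bra <| jump .copyStep
    -- The closing bracket is counted too: one round more than the number of symbols.
    | _ => pushSymbol .counter .ket <| setFlags (fun f => { f with phase := .steps }) <|
        jump .rewind
  | .copyStep => popCase .input fun
    | some .ket => pushSymbol .stepsDone .ket <| pushSymbol .counter .ket <| jump .copySteps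
    | some x => pushSymbol .stepsDone x <| pushSymbol .counter x <| jump .copyStep
    | none => halt
  | .rewind => popCase .stepsDone fun
    | some x => pushSymbol .steps x <| jump .rewind
    | none => popCase .counter fun
      | some _ => jump .readSource
      | none => setFlags (fun f => { f with phase := .formula }) <| jump .readFormula
  | .readSource => popCase .steps fun
    | some .bra => pushSymbol .stepsDone .bra <| setFlags (fun f => { f with ok := true }) <|
        jump .readSource
    | some .ket => pushSymbol .stepsDone .ket <|
        ifFlags (fun f => f.ok) (setFlags (fun f => { f with ok := false }) <| jump .transfer)
          (jump .discard)
    | some .endNum => pushSymbol .stepsDone .endNum <| jump .reverse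
    | some x => pushSymbol .stepsDone x <| pushSymbol .num x <| jump .readSource
    | none => jump .rewind
  | .readTarget => popCase .steps fun
    | some .endNum => pushSymbol .stepsDone .endNum <| jump .readMult
    | some x => pushSymbol .stepsDone x <| pushSymbol .fresh x <| jump .readTarget
    | none => halt
  | .readMult => popCase .steps fun
    | some .endNum => pushSymbol .stepsDone .endNum <|
        pushFlags .fresh (fun f => mark f.pos) <|
        setFlags (fun f => { f with
          found := false, ok := f.ok && (!f.pos || f.found), pos := false }) <|
        jump .readSource
    | some x => pushSymbol .stepsDone x <| setFlags (fun f => { f with pos := true }) <|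
        jump .readMult
    | none => halt
  | .discard => popCase .fresh fun
    | some _ => jump .discard
    | none => jump .readSource
  | .reverse => popCase .num fun
    | some x => pushSymbol .numDone x <| jump .reverse
    | none => jump .compare
  | .compare => popCase .known fun
    | some (.bit b) => pushSymbol .knownDone (.bit b) <| popCase .numDone fun
      | some x => pushSymbol .num x <|
          setFlags (fun f => { f with eq := f.eq && decide (x = .bit b) }) <| jump .compare
      | none => setFlags (fun f => { f with eq := false }) <| jump .compare
    | some m => pushSymbol .knownDone m <| popCase .numDone fun
      | some x => pushSymbol .numDone x <| setFlags (fun f => { f with eq := true }) <|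
          jump .reverse
      | none => setFlags (fun f => { f with
            found := f.found || (f.eq && decide (m = .endNum)), eq := true }) <| jump .reverse
    | none => jump .erase
  | .erase => popCase .numDone fun
    | some _ => jump .erase
    | none => jump .restore
  | .restore => popCase .knownDone fun
    | some x => pushSymbol .known x <| jump .restore
    | none => ifFlags (fun f => decide (f.phase = .formula)) (jump .readBound) (jump .readTarget)
  | .readFormula => popCase .input fun
    | some .geq => jump .readFormula
    | some .and => pushSymbol .formula .and <| jump .readFormula
    | some .or => pushSymbol .formula .or <| jump .readFormula
    | some .endNum => jump .reverse
    | some x => pushSymbol .num x <| jump .readFormula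
    | none => jump .evaluate
  | .readBound => popCase .input fun
    | some .endNum => pushFlags .formula (fun f => .bit (f.found || !f.pos)) <|
        setFlags (fun f => { f with found := false, pos := false }) <| jump .readFormula
    | some _ => setFlags (fun f => { f with pos := true }) <| jump .readBound
    | none => halt
  | .evaluate => popCase .formula fun
    | some (.bit b) => pushOutput b <| jump .evaluate
    | some .and => applyBinary and <| jump .evaluate
    | some .or => applyBinary or <| jump .evaluate
    | some _ => halt
    | none => jump .cleanSteps
  | .cleanSteps => popCase .steps fun
    | some _ => jump .cleanSteps
    | none => jump .cleanKnown
  | .cleanKnown => popCase .known fun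
    | some _ => jump .cleanKnown
    | none => setFlags (fun _ => {}) halt

/-- The machine that runs `program`; all its stacks have finite alphabets. -/
def machine : Turing.FinTM2 where
  K := Option WorkStack
  k₀ := some .input
  k₁ := none
  Γ := StackSymbol
  Λ := Label
  main := .skipSize
  σ := Memory
  initialState := (none, {})
  Γk₀Fin := inferInstanceAs (Fintype CRPSymbol)
  m := program

/-- The contents of all stacks. -/
structure Stacks : Type where
  input : List CRPSymbol := []
  steps : List CRPSymbol := []
  stepsDone : List CRPSymbol := []
  counter : List CRPSymbol := []
  fresh : List CRPSymbol := []
  known : List CRPSymbol := []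
  knownDone : List CRPSymbol := []
  num : List CRPSymbol := []
  numDone : List CRPSymbol := []
  formula : List CRPSymbol := []
  output : List Bool := []

namespace Stacks

def get (s : Stacks) : ∀ k, List (StackSymbol k)
  | none => s.output
  | some .input => s.input
  | some .steps => s.steps
  | some .stepsDone => s.stepsDone
  | some .counter => s.counter
  | some .fresh => s.fresh
  | some .known => s.known
  | some .knownDone => s.knownDone
  | some .num => s.num
  | some .numDone => s.numDone
  | some .formula => s.formula

/-- Replace the contents of a work stack. -/
def set (s : Stacks) : WorkStack → List CRPSymbol → Stacks
  | .input, l => { s with input := l }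
  | .steps, l => { s with steps := l }
  | .stepsDone, l => { s with stepsDone := l }
  | .counter, l => { s with counter := l }
  | .fresh, l => { s with fresh := l }
  | .known, l => { s with known := l }
  | .knownDone, l => { s with knownDone := l }
  | .num, l => { s with num := l }
  | .numDone, l => { s with numDone := l }
  | .formula, l => { s with formula := l }

theorem update_get_some (s : Stacks) (k : WorkStack) (l : List CRPSymbol) :
    Function.update (β := fun k => List (StackSymbol k)) s.get (some k) l = (s.set k l).get := by
  funext j
  rcases j with _ | j
  · cases k <;> rfl
  · cases k <;> cases j <;> rfl

theorem update_get_none (s : Stacks) (l : List Bool) :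
    Function.update (β := fun k => List (StackSymbol k)) s.get none l =
      { s with output := l }.get := by
  funext j
  rcases j with _ | j
  · rfl
  · cases j <;> rfl

end Stacks

/-- The configuration at a label, between two steps. -/
def cfg (l : Option Label) (f : Flags) (s : Stacks) : Turing.TM2.Cfg StackSymbol Label Memory :=
  ⟨l, (none, f), s.get⟩

/-- The result of executing a piece of code. -/
def exec (q : Code) (f : Flags) (s : Stacks) : Turing.TM2.Cfg StackSymbol Label Memory :=
  Turing.TM2.stepAux q (none, f) s.get

variable {f : Flags} {s : Stacks}

@[simp] theorem exec_jump {l : Label} : exec (jump l) f s = cfg (some l) f s := rfl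

@[simp] theorem exec_halt : exec halt f s = cfg none f s := rfl

@[simp] theorem exec_setFlags {g : Flags → Flags} {q : Code} :
    exec (setFlags g q) f s = exec q (g f) s := rfl

@[simp] theorem exec_ifFlags {g : Flags → Bool} {q q' : Code} :
    exec (ifFlags g q q') f s = if g f then exec q f s else exec q' f s := by
  simp only [exec, ifFlags, Turing.TM2.stepAux]
  cases g f <;> rfl

@[simp] theorem exec_pushFlags {k : WorkStack} {g : Flags → CRPSymbol} {q : Code} :
    exec (pushFlags k g q) f s = exec q f (s.set k (g f :: s.get (some k))) := by
  simp only [exec, pushFlags, Turing.TM2.stepAux]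
  rw [Stacks.update_get_some]

@[simp] theorem exec_pushSymbol {k : WorkStack} {x : CRPSymbol} {q : Code} :
    exec (pushSymbol k x q) f s = exec q f (s.set k (x :: s.get (some k))) :=
  exec_pushFlags

@[simp] theorem exec_pushOutput {b : Bool} {q : Code} :
    exec (pushOutput b q) f s = exec q f { s with output := b :: s.output } := by
  simp only [exec, pushOutput, Turing.TM2.stepAux]
  rw [Stacks.update_get_none]
  rfl

@[simp] theorem exec_popCase {k : WorkStack} {g : Option CRPSymbol → Code} :
    exec (popCase k g) f s =
      exec (g (s.get (some k)).head?) f (s.set k (s.get (some k)).tail) := by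
  simp only [exec, popCase, testSymbol, Turing.TM2.stepAux]
  rw [Stacks.update_get_some]
  rcases (s.get (some k)).head? with _ | ((_ | _) | _ | _ | _ | _ | _ | _) <;> rfl

@[simp] theorem exec_applyBinary {op : Bool → Bool → Bool} {q : Code} :
    exec (applyBinary op q) f s = exec q { f with found := false } { s with
      output := op (s.output.head? == some true) (s.output.tail.head? == some true) ::
        s.output.tail.tail } := by
  simp only [exec, applyBinary, setFlags, Turing.TM2.stepAux, Function.update_self,
    Stacks.update_get_none]
  rfl

/-- `c'` is reached from `c` in at most `t` steps. -/
def Runs (c c' : Turing.TM2.Cfg StackSymbol Label Memory) (t : ℕ) : Prop :=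
  ∃ k ≤ t, (flip bind (Turing.TM2.step program))^[k] (some c) = some c'

theorem Runs.refl (c) : Runs c c 0 := ⟨0, le_rfl, rfl⟩

theorem Runs.mono {c c'} {t t' : ℕ} (h : Runs c c' t) (ht : t ≤ t') : Runs c c' t' :=
  let ⟨k, hk, h⟩ := h
  ⟨k, hk.trans ht, h⟩

theorem Runs.trans {c c' c''} {t t' : ℕ} (h : Runs c c' t) (h' : Runs c' c'' t') :
    Runs c c'' (t + t') := by
  obtain ⟨k, hk, h⟩ := h
  obtain ⟨k', hk', h'⟩ := h'
  refine ⟨k' + k, by omega, ?_⟩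
  rw [Function.iterate_add_apply, h, h']

/-- One step of the machine, followed by further ones. -/
theorem Runs.head {l : Label} {c'} {t : ℕ} (h : Runs (exec (program l) f s) c' t) :
    Runs (cfg (some l) f s) c' (t + 1) := by
  obtain ⟨k, hk, h⟩ := h
  exact ⟨k + 1, by omega, h⟩

/-! ### Loops that move or erase the contents of a stack -/

theorem runs_transfer (l : List CRPSymbol) :
    Runs (cfg (some .transfer) f { s with fresh := l })
      (cfg (some .transfer) f { s with fresh := [], known := l.reverse ++ s.known }) l.length := by
  induction l generalizing s with
  | nil => exact .refl _
  | cons x l ih =>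
    refine .head ?_
    simpa [program, Stacks.get, Stacks.set] using ih (s := { s with known := x :: s.known })

theorem runs_rewind (l : List CRPSymbol) :
    Runs (cfg (some .rewind) f { s with stepsDone := l })
      (cfg (some .rewind) f { s with stepsDone := [], steps := l.reverse ++ s.steps })
      l.length := by
  induction l generalizing s with
  | nil => exact .refl _
  | cons x l ih =>
    refine .head ?_
    simpa [program, Stacks.get, Stacks.set] using ih (s := { s with steps := x :: s.steps })

theorem runs_reverse (l : List CRPSymbol) :
    Runs (cfg (some .reverse) f { s with num := l })
      (cfg (some .compare) f { s with num := [], numDone := l.reverse ++ s.numDone })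
      (l.length + 1) := by
  induction l generalizing s with
  | nil => exact .head (by simpa [program, Stacks.get, Stacks.set] using Runs.refl _)
  | cons x l ih =>
    refine .head ?_
    simpa [program, Stacks.get, Stacks.set] using ih (s := { s with numDone := x :: s.numDone })

theorem runs_restore (l : List CRPSymbol) :
    Runs (cfg (some .restore) f { s with knownDone := l })
      (cfg (some (if f.phase = .formula then .readBound else .readTarget)) f
        { s with knownDone := [], known := l.reverse ++ s.known }) (l.length + 1) := by
  induction l generalizing s with
  | nil =>
    exact .head (by
      by_cases h : f.phase = .formula <;>
        simpa [program, Stacks.get, Stacks.set, h] using Runs.refl _)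
  | cons x l ih =>
    refine .head ?_
    simpa [program, Stacks.get, Stacks.set] using ih (s := { s with known := x :: s.known })

theorem runs_discard (l : List CRPSymbol) :
    Runs (cfg (some .discard) f { s with fresh := l })
      (cfg (some .readSource) f { s with fresh := [] }) (l.length + 1) := by
  induction l with
  | nil => exact .head (by simpa [program, Stacks.get, Stacks.set] using Runs.refl _)
  | cons x l ih => exact .head (by simpa [program, Stacks.get, Stacks.set] using ih)

theorem runs_erase (l : List CRPSymbol) :
    Runs (cfg (some .erase) f { s with numDone := l })
      (cfg (some .restore) f { s with numDone := [] }) (l.length + 1) := by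
  induction l with
  | nil => exact .head (by simpa [program, Stacks.get, Stacks.set] using Runs.refl _)
  | cons x l ih => exact .head (by simpa [program, Stacks.get, Stacks.set] using ih)

theorem runs_cleanSteps (l : List CRPSymbol) :
    Runs (cfg (some .cleanSteps) f { s with steps := l })
      (cfg (some .cleanKnown) f { s with steps := [] }) (l.length + 1) := by
  induction l with
  | nil => exact .head (by simpa [program, Stacks.get, Stacks.set] using Runs.refl _)
  | cons x l ih => exact .head (by simpa [program, Stacks.get, Stacks.set] using ih)

theorem runs_cleanKnown (l : List CRPSymbol) :
    Runs (cfg (some .cleanKnown) f { s with known := l })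
      (cfg none {} { s with known := [] }) (l.length + 1) := by
  induction l with
  | nil => exact .head (by simpa [program, Stacks.get, Stacks.set] using Runs.refl _)
  | cons x l ih => exact .head (by simpa [program, Stacks.get, Stacks.set] using ih)

/-! ### Searching for a state -/

/-- The binary representation of a number, without end marker. -/
def digits (a : ℕ) : List CRPSymbol := (Computability.encodeNat a).map CRPSymbol.bit

theorem encodeNumber_eq (a : ℕ) : encodeNumber a = digits a ++ [.endNum] := rfl

theorem encodeNat_inj {a b : ℕ} : Computability.encodeNat a = Computability.encodeNat b ↔ a = b :=
  ⟨fun h => by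
    rw [← Computability.decode_encodeNat a, h, Computability.decode_encodeNat], fun h => h ▸ rfl⟩

/-- The contents of the stack `known`. -/
def encodeKnown {n : ℕ} (K : KnownList n) : List CRPSymbol :=
  K.flatMap fun e => digits e.2.val ++ [mark e.1]

@[simp] theorem encodeKnown_nil {n : ℕ} : encodeKnown ([] : KnownList n) = [] := rfl

@[simp] theorem encodeKnown_cons {n : ℕ} (e : Bool × Fin n) (K : KnownList n) :
    encodeKnown (e :: K) = digits e.2.val ++ mark e.1 :: encodeKnown K := by
  simp [encodeKnown]

@[simp] theorem encodeKnown_append {n : ℕ} (K K' : KnownList n) :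
    encodeKnown (K ++ K') = encodeKnown K ++ encodeKnown K' := by
  simp [encodeKnown]

/-- Comparing with one entry of the list. The number is `acc.reverse` followed by `ps`, where
`acc` has already been compared, with result `e`. -/
theorem runs_compare_entry (bs ps : List Bool) (acc rest : List CRPSymbol) {fd e ok pos m : Bool}
    {ph : Phase} :
    Runs (cfg (some .compare) ⟨fd, e, ok, pos, ph⟩
        { s with known := bs.map .bit ++ mark m :: rest, numDone := ps.map .bit, num := acc })
      (cfg (some .compare) ⟨fd || (e && decide (bs = ps) && m), true, ok, pos, ph⟩
        { s with
          known := rest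
          knownDone := mark m :: ((bs.map .bit).reverse ++ s.knownDone)
          numDone := acc.reverse ++ ps.map .bit
          num := [] })
      (2 * bs.length + acc.length + 2) := by
  induction bs generalizing ps acc s e with
  | nil =>
    have hr := runs_reverse (f := ⟨fd || (e && decide ([] = ps) && m), true, ok, pos, ph⟩)
      (s := { s with known := rest, knownDone := mark m :: s.knownDone, numDone := ps.map .bit })
      acc
    refine Runs.mono (.head (t := acc.length + 1) ?_) (by simp)
    cases ps <;> cases m <;> simpa [program, Stacks.get, Stacks.set, mark] using hr
  | cons b bs ih =>
    cases ps with
    | nil =>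
      refine Runs.mono (.head (t := 2 * bs.length + acc.length + 2) ?_) (by simp)
      simpa [program, Stacks.get, Stacks.set] using
        ih [] acc (e := false) (s := { s with knownDone := .bit b :: s.knownDone })
    | cons c ps =>
      refine Runs.mono (.head (t := 2 * bs.length + (acc.length + 1) + 2) ?_) (by simp; omega)
      have := ih ps (.bit c :: acc) (e := e && decide (c = b))
        (s := { s with knownDone := .bit b :: s.knownDone })
      simpa [program, Stacks.get, Stacks.set, Bool.and_assoc, eq_comm (a := b)] using this

theorem runs_compare {n : ℕ} (K : KnownList n) (p : Fin n) {fd ok pos : Bool} {ph : Phase} :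
    Runs (cfg (some .compare) ⟨fd, true, ok, pos, ph⟩
        { s with known := encodeKnown K, numDone := digits p, num := [] })
      (cfg (some .erase) ⟨fd || decide ((true, p) ∈ K), true, ok, pos, ph⟩
        { s with
          known := []
          knownDone := (encodeKnown K).reverse ++ s.knownDone
          numDone := digits p
          num := [] })
      (2 * (encodeKnown K).length + 1) := by
  induction K generalizing s fd with
  | nil => exact .head (by simpa [program, Stacks.get, Stacks.set] using Runs.refl _)
  | cons e K ih =>
    obtain ⟨m, q⟩ := e
    have h₁ := runs_compare_entry (s := s) (Computability.encodeNat q) (Computability.encodeNat p)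
      [] (encodeKnown K) (fd := fd) (e := true) (ok := ok) (pos := pos) (m := m) (ph := ph)
    have h₂ := ih (s := { s with knownDone := mark m :: ((digits q).reverse ++ s.knownDone) })
      (fd := fd || (decide (q = p) && m))
    have hmem : (fd || decide ((true, p) ∈ (m, q) :: K)) =
        (fd || (decide (q = p) && m) || decide ((true, p) ∈ K)) := by
      cases m <;> simp [eq_comm (a := p), Bool.or_assoc]
    rw [hmem, encodeKnown_cons]
    simp only [encodeNat_inj, Fin.val_inj, List.reverse_nil, List.nil_append, Bool.true_and] at h₁
    refine Runs.mono (h₁.trans (t' := 2 * (encodeKnown K).length + 1) ?_)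
      (by simp [digits]; omega)
    simpa [digits] using h₂

/-- The search for the number `p`, from the moment when its digits have been read. -/
theorem runs_search {n : ℕ} (K : KnownList n) (p : Fin n) {ok pos : Bool} {ph : Phase} :
    Runs (cfg (some .reverse) ⟨false, true, ok, pos, ph⟩
        { s with
          known := encodeKnown K, knownDone := [], num := (digits p).reverse, numDone := [] })
      (cfg (some (if ph = .formula then .readBound else .readTarget))
        ⟨decide ((true, p) ∈ K), true, ok, pos, ph⟩
        { s with known := encodeKnown K, knownDone := [], num := [], numDone := [] })
      (2 * (digits p).length + 3 * (encodeKnown K).length + 4) := by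
  have h₁ := runs_reverse (f := ⟨false, true, ok, pos, ph⟩)
    (s := { s with known := encodeKnown K, knownDone := [], numDone := [] }) (digits p).reverse
  have h₂ := runs_compare (s := { s with knownDone := [] }) K p (fd := false) (ok := ok)
    (pos := pos) (ph := ph)
  have h₃ := runs_erase (f := ⟨decide ((true, p) ∈ K), true, ok, pos, ph⟩)
    (s := { s with known := [], knownDone := (encodeKnown K).reverse, num := [] }) (digits p)
  have h₄ := runs_restore (f := ⟨decide ((true, p) ∈ K), true, ok, pos, ph⟩)
    (s := { s with known := [], numDone := [], num := [] }) (encodeKnown K).reverse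
  simp only [List.reverse_reverse, List.append_nil, List.length_reverse,
    Bool.false_or] at h₁ h₂ h₃ h₄
  exact (h₁.trans (h₂.trans (h₃.trans h₄))).mono (by omega)

/-! ### Reading a step -/

theorem runs_readSource_digits (bs : List Bool) (acc rest : List CRPSymbol) :
    Runs (cfg (some .readSource) f { s with steps := bs.map .bit ++ rest, num := acc })
      (cfg (some .readSource) f { s with
        steps := rest
        stepsDone := (bs.map .bit).reverse ++ s.stepsDone
        num := (bs.map .bit).reverse ++ acc }) bs.length := by
  induction bs generalizing s acc with
  | nil => exact .refl _
  | cons b bs ih =>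
    refine .head ?_
    have := ih (s := { s with stepsDone := .bit b :: s.stepsDone }) (.bit b :: acc)
    simpa [program, Stacks.get, Stacks.set] using this

theorem runs_readTarget (bs : List Bool) (rest : List CRPSymbol) :
    Runs (cfg (some .readTarget) f { s with steps := bs.map .bit ++ .endNum :: rest })
      (cfg (some .readMult) f { s with
        steps := rest
        stepsDone := .endNum :: ((bs.map .bit).reverse ++ s.stepsDone)
        fresh := (bs.map .bit).reverse ++ s.fresh }) (bs.length + 1) := by
  induction bs generalizing s with
  | nil => exact .head (by simpa [program, Stacks.get, Stacks.set] using Runs.refl _)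
  | cons b bs ih =>
    refine .head ?_
    have := ih (s := { s with stepsDone := .bit b :: s.stepsDone, fresh := .bit b :: s.fresh })
    simpa [program, Stacks.get, Stacks.set] using this

theorem runs_readMult (bs : List Bool) (rest : List CRPSymbol) {fd e ok pos : Bool} {ph : Phase} :
    Runs (cfg (some .readMult) ⟨fd, e, ok, pos, ph⟩
        { s with steps := bs.map .bit ++ .endNum :: rest })
      (cfg (some .readSource)
        ⟨false, e, ok && (!(pos || !bs.isEmpty) || fd), false, ph⟩ { s with
        steps := rest
        stepsDone := .endNum :: ((bs.map .bit).reverse ++ s.stepsDone)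
        fresh := mark (pos || !bs.isEmpty) :: s.fresh }) (bs.length + 1) := by
  induction bs generalizing s pos with
  | nil => exact .head (by simpa [program, Stacks.get, Stacks.set] using Runs.refl _)
  | cons b bs ih =>
    refine .head ?_
    have := ih (s := { s with stepsDone := .bit b :: s.stepsDone }) (pos := true)
    simpa [program, Stacks.get, Stacks.set] using this

theorem isEmpty_encodeNat (a : ℕ) : (Computability.encodeNat a).isEmpty = decide (a = 0) := by
  rw [Bool.eq_iff_iff, List.isEmpty_iff, decide_eq_true_iff, ← encodeNat_inj (b := 0)]
  rfl

/-- A transition with its multiplicity, as it stands in the input. -/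
def encodeEntry {n : ℕ} (e : (Fin n × Fin n) × ℕ) : List CRPSymbol :=
  encodeNumber e.1.1.val ++ encodeNumber e.1.2.val ++ encodeNumber e.2

def encodeEntries {n : ℕ} (L : StepList n) : List CRPSymbol := L.flatMap encodeEntry

theorem encode_stepList {n : ℕ} (L : StepList n) :
    L.encode = .bra :: (encodeEntries L ++ [.ket]) := rfl

/-- Reading one transition: its source is searched for, and its target is put on the stack
`fresh`, with a marker that tells whether the multiplicity is positive. -/
theorem runs_readEntry {n : ℕ} (K : KnownList n) (e : (Fin n × Fin n) × ℕ)
    (rest : List CRPSymbol) {ok : Bool} :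
    Runs (cfg (some .readSource) ⟨false, true, ok, false, .steps⟩ { s with
          steps := encodeEntry e ++ rest
          known := encodeKnown K, knownDone := [], num := [], numDone := [] })
      (cfg (some .readSource)
        ⟨false, true, ok && (decide (e.2 = 0) || decide ((true, e.1.1) ∈ K)), false, .steps⟩
        { s with
          steps := rest
          stepsDone := (encodeEntry e).reverse ++ s.stepsDone
          fresh := (digits e.1.2 ++ [mark (decide (e.2 ≠ 0))]).reverse ++ s.fresh
          known := encodeKnown K, knownDone := [], num := [], numDone := [] })
      (3 * (encodeEntry e).length + 3 * (encodeKnown K).length) := by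
  obtain ⟨⟨p, q⟩, m⟩ := e
  have h₁ := runs_readSource_digits (f := ⟨false, true, ok, false, .steps⟩)
    (s := { s with known := encodeKnown K, knownDone := [], numDone := [] })
    (Computability.encodeNat p) [] (.endNum :: (encodeNumber q.val ++ encodeNumber m ++ rest))
  have h₂ := runs_search
    (s := { s with
      steps := encodeNumber q.val ++ encodeNumber m ++ rest
      stepsDone := .endNum :: ((digits p).reverse ++ s.stepsDone) })
    K p (ok := ok) (pos := false) (ph := .steps)
  have h₃ := runs_readTarget (f := ⟨decide ((true, p) ∈ K), true, ok, false, .steps⟩)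
    (s := { s with
      stepsDone := .endNum :: ((digits p).reverse ++ s.stepsDone)
      known := encodeKnown K, knownDone := [], num := [], numDone := [] })
    (Computability.encodeNat q) (encodeNumber m ++ rest)
  have h₄ := runs_readMult (fd := decide ((true, p) ∈ K)) (e := true) (ok := ok) (pos := false)
    (ph := .steps)
    (s := { s with
      stepsDone := (encodeNumber p.val ++ encodeNumber q.val).reverse ++ s.stepsDone
      fresh := (digits q).reverse ++ s.fresh
      known := encodeKnown K, knownDone := [], num := [], numDone := [] })
    (Computability.encodeNat m) rest
  simp only [isEmpty_encodeNat, encodeNumber_eq, digits, encodeEntry, List.reverse_append,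
    List.append_assoc, List.cons_append, List.nil_append, List.reverse_cons, List.append_nil,
    List.reverse_nil, Bool.false_or, decide_not, Bool.not_not,
    if_neg (show ¬ Phase.steps = Phase.formula by decide)] at h₁ h₂ h₃ h₄ ⊢
  refine Runs.mono (h₁.trans (.head (t := ?t) ?run)) ?le
  case run =>
    simp only [program, exec_popCase, Stacks.get, List.head?_cons, exec_pushSymbol, exec_jump,
      Stacks.set, List.tail_cons]
    exact h₂.trans (h₃.trans h₄)
  case le =>
    simp
    omega

theorem length_encodeKnown_targets {n : ℕ} (L : StepList n) :
    (encodeKnown (KnownList.targets L)).length ≤ (encodeEntries L).length := by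
  induction L with
  | nil => simp [KnownList.targets]
  | cons e L ih =>
    simp only [KnownList.targets, List.map_cons, encodeKnown_cons, encodeEntries,
      List.flatMap_cons, List.length_append, List.length_cons] at ih ⊢
    simp only [encodeEntry, encodeNumber_eq, List.length_append, List.length_singleton]
    omega

theorem runs_readEntries {n : ℕ} (K : KnownList n) (L : StepList n) (rest : List CRPSymbol)
    {ok : Bool} :
    Runs (cfg (some .readSource) ⟨false, true, ok, false, .steps⟩ { s with
          steps := encodeEntries L ++ rest
          known := encodeKnown K, knownDone := [], num := [], numDone := [] })
      (cfg (some .readSource) ⟨false, true, ok && K.enables L, false, .steps⟩ { s with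
          steps := rest
          stepsDone := (encodeEntries L).reverse ++ s.stepsDone
          fresh := (encodeKnown (KnownList.targets L)).reverse ++ s.fresh
          known := encodeKnown K, knownDone := [], num := [], numDone := [] })
      ((encodeEntries L).length * (3 * (encodeKnown K).length + 3)) := by
  induction L generalizing s ok with
  | nil =>
    simpa [encodeEntries, KnownList.targets, KnownList.enables] using Runs.refl _
  | cons e L ih =>
    have h₁ := runs_readEntry (s := s) K e (encodeEntries L ++ rest) (ok := ok)
    have h₂ := ih (ok := ok && (decide (e.2 = 0) || decide ((true, e.1.1) ∈ K)))
      (s := { s with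
        stepsDone := (encodeEntry e).reverse ++ s.stepsDone
        fresh := (digits e.1.2 ++ [mark (decide (e.2 ≠ 0))]).reverse ++ s.fresh })
    have hlen : 1 ≤ (encodeEntry e).length := by
      simp [encodeEntry, encodeNumber_eq]
      omega
    have h := h₁.trans h₂
    simp only [encodeEntries, KnownList.targets, KnownList.enables, List.flatMap_cons,
      List.map_cons, encodeKnown_cons, List.all_cons, List.reverse_append, List.reverse_cons,
      List.append_assoc, List.length_append, List.nil_append, List.cons_append, List.reverse_nil,
      Bool.and_assoc] at h ⊢
    refine h.mono ?_
    nlinarith [Nat.mul_le_mul_right (3 * (encodeKnown K).length) hlen]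

theorem runs_step {n : ℕ} (K : KnownList n) (L : StepList n) (rest : List CRPSymbol) :
    Runs (cfg (some .readSource) ⟨false, true, false, false, .steps⟩ { s with
          steps := L.encode ++ rest, fresh := []
          known := encodeKnown K, knownDone := [], num := [], numDone := [] })
      (cfg (some .readSource) ⟨false, true, false, false, .steps⟩ { s with
          steps := rest
          stepsDone := L.encode.reverse ++ s.stepsDone
          fresh := []
          known := encodeKnown (K.fire L), knownDone := [], num := [], numDone := [] })
      (L.encode.length * (3 * (encodeKnown K).length + 4)) := by
  have h₁ := runs_readEntries
    (s := { s with stepsDone := .bra :: s.stepsDone, fresh := [] }) K L (.ket :: rest) (ok := true)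
  have h₂ := runs_transfer (f := ⟨false, true, false, false, .steps⟩)
    (s := { s with
      steps := rest, stepsDone := L.encode.reverse ++ s.stepsDone
      known := encodeKnown K, knownDone := [], num := [], numDone := [] })
    (encodeKnown (KnownList.targets L)).reverse
  have h₃ := runs_discard (f := ⟨false, true, false, false, .steps⟩)
    (s := { s with
      steps := rest, stepsDone := L.encode.reverse ++ s.stepsDone
      known := encodeKnown K, knownDone := [], num := [], numDone := [] })
    (encodeKnown (KnownList.targets L)).reverse
  have hlen := length_encodeKnown_targets L
  simp only [encode_stepList, Bool.true_and, List.append_nil] at h₁ h₂ h₃ ⊢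
  refine Runs.mono (.head (t := ?t) ?run) ?le
  case run =>
    simp only [program, exec_popCase, Stacks.get, exec_pushSymbol, exec_jump, exec_setFlags,
      Stacks.set, List.tail_cons, List.cons_append, List.append_assoc, List.nil_append,
      List.head?_cons]
    refine h₁.trans (t' := (encodeKnown (KnownList.targets L)).length + 1 + 1) (.head ?_)
    cases hen : K.enables L
    · simpa [program, Stacks.get, Stacks.set, KnownList.fire, hen] using h₃
    · rw [List.length_reverse] at h₂
      have h₄ := h₂.trans (.head (Runs.refl _))
      simpa [program, Stacks.get, Stacks.set, KnownList.fire, hen] using h₄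
  case le =>
    simp only [List.length_cons, List.length_append, List.length_nil]
    nlinarith

theorem length_encodeKnown_fire_le {n : ℕ} (K : KnownList n) (L : StepList n) :
    (encodeKnown (K.fire L)).length ≤ (encodeKnown K).length + L.encode.length := by
  have := length_encodeKnown_targets L
  unfold KnownList.fire
  split_ifs <;> simp [encode_stepList]
  omega

theorem length_encodeKnown_le_fire {n : ℕ} (K : KnownList n) (L : StepList n) :
    (encodeKnown K).length ≤ (encodeKnown (K.fire L)).length := by
  unfold KnownList.fire
  split_ifs <;> simp

theorem length_encodeKnown_round_le {n : ℕ} (steps : List (StepList n)) (K : KnownList n) :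
    (encodeKnown (K.round steps)).length ≤
      (encodeKnown K).length + (steps.flatMap StepList.encode).length := by
  induction steps generalizing K with
  | nil => simp [KnownList.round]
  | cons L steps ih =>
    have h₁ := ih (K.fire L)
    have h₂ := length_encodeKnown_fire_le K L
    simp only [KnownList.round, List.foldl_cons, List.flatMap_cons, List.length_append] at h₁ ⊢
    omega

theorem length_encodeKnown_le_round {n : ℕ} (steps : List (StepList n)) (K : KnownList n) :
    (encodeKnown K).length ≤ (encodeKnown (K.round steps)).length := by
  induction steps generalizing K with
  | nil => exact le_rfl
  | cons L steps ih => exact (length_encodeKnown_le_fire K L).trans (ih _)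

theorem runs_round {n : ℕ} (steps : List (StepList n)) (K : KnownList n) {M : ℕ}
    (hM : (encodeKnown (K.round steps)).length ≤ M) :
    Runs (cfg (some .readSource) ⟨false, true, false, false, .steps⟩ { s with
          steps := steps.flatMap StepList.encode, fresh := []
          known := encodeKnown K, knownDone := [], num := [], numDone := [] })
      (cfg (some .rewind) ⟨false, true, false, false, .steps⟩ { s with
          steps := []
          stepsDone := (steps.flatMap StepList.encode).reverse ++ s.stepsDone
          fresh := []
          known := encodeKnown (K.round steps), knownDone := [], num := [], numDone := [] })
      ((steps.flatMap StepList.encode).length * (3 * M + 4) + 1) := by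
  induction steps generalizing s K with
  | nil =>
    refine .head ?_
    simpa [program, Stacks.get, Stacks.set, KnownList.round] using Runs.refl _
  | cons L steps ih =>
    have h₁ := runs_step (s := s) K L (steps.flatMap StepList.encode)
    have h₂ := ih (K.fire L) hM
      (s := { s with stepsDone := L.encode.reverse ++ s.stepsDone })
    have hK : (encodeKnown K).length ≤ M :=
      (length_encodeKnown_le_round (L :: steps) K).trans hM
    have h := h₁.trans h₂
    simp only [List.flatMap_cons, List.reverse_append, List.append_assoc, List.length_append,
      KnownList.round, List.foldl_cons] at h ⊢
    refine h.mono ?_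
    have := Nat.mul_le_mul_left L.encode.length
      (show 3 * (encodeKnown K).length + 4 ≤ 3 * M + 4 by omega)
    linarith

theorem length_encodeKnown_iterate_round_le {n : ℕ} (steps : List (StepList n))
    (K : KnownList n) (c : ℕ) :
    (encodeKnown ((KnownList.round steps)^[c] K)).length ≤
      (encodeKnown K).length + c * (steps.flatMap StepList.encode).length := by
  induction c with
  | zero => simp
  | succ c ih =>
    rw [Function.iterate_succ_apply']
    have := length_encodeKnown_round_le steps ((KnownList.round steps)^[c] K)
    linarith

theorem length_encodeKnown_le_iterate_round {n : ℕ} (steps : List (StepList n))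
    (K : KnownList n) (c : ℕ) :
    (encodeKnown K).length ≤ (encodeKnown ((KnownList.round steps)^[c] K)).length := by
  induction c generalizing K with
  | zero => exact le_rfl
  | succ c ih => exact (length_encodeKnown_le_round steps K).trans (ih _)

/-- All rounds; the length of the stack `counter` is the number of rounds. -/
theorem runs_rounds {n : ℕ} (steps : List (StepList n)) (K : KnownList n) (c : List CRPSymbol)
    {M : ℕ} (hM : (encodeKnown ((KnownList.round steps)^[c.length] K)).length ≤ M) :
    Runs (cfg (some .rewind) ⟨false, true, false, false, .steps⟩ { s with
          steps := [], stepsDone := (steps.flatMap StepList.encode).reverse, counter := c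
          fresh := [], known := encodeKnown K, knownDone := [], num := [], numDone := [] })
      (cfg (some .readFormula) ⟨false, true, false, false, .formula⟩ { s with
          steps := steps.flatMap StepList.encode, stepsDone := [], counter := [], fresh := []
          known := encodeKnown ((KnownList.round steps)^[c.length] K)
          knownDone := [], num := [], numDone := [] })
      ((c.length + 1) * ((steps.flatMap StepList.encode).length * (3 * M + 5) + 2)) := by
  induction c generalizing s K with
  | nil =>
    have h := runs_rewind (f := ⟨false, true, false, false, .steps⟩)
      (s := { s with
        steps := [], counter := []
        fresh := [], known := encodeKnown K, knownDone := [], num := [], numDone := [] })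
      (steps.flatMap StepList.encode).reverse
    simp only [List.reverse_reverse, List.append_nil, List.length_reverse] at h
    refine Runs.mono (h.trans (t' := 0 + 1) (.head ?_)) ?_
    · simpa [program, Stacks.get, Stacks.set] using Runs.refl _
    · simp only [List.length_nil]
      nlinarith
  | cons x c ih =>
    have h₁ := runs_rewind (f := ⟨false, true, false, false, .steps⟩)
      (s := { s with
        steps := [], counter := x :: c
        fresh := [], known := encodeKnown K, knownDone := [], num := [], numDone := [] })
      (steps.flatMap StepList.encode).reverse
    have h₂ := runs_round (s := { s with stepsDone := [], counter := c }) steps K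
      ((length_encodeKnown_le_iterate_round steps _ c.length).trans hM)
    have h₃ := ih (K.round steps) hM (s := s)
    simp only [List.reverse_reverse, List.append_nil, List.length_reverse] at h₁ h₂
    have h₄ := h₂.trans h₃
    refine Runs.mono (h₁.trans (.head (t := ?t) ?run)) ?le
    case run => simpa [program, Stacks.get, Stacks.set, -List.length_flatMap] using h₄
    case le =>
      simp only [List.length_cons]
      nlinarith

/-! ### Distributing the input -/

theorem runs_skipSize (l rest : List CRPSymbol) (hl : .bra ∉ l) :
    Runs (cfg (some .skipSize) f { s with input := l ++ .bra :: rest })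
      (cfg (some .readInit) f { s with input := rest }) (l.length + 1) := by
  induction l with
  | nil => exact .head (by simpa [program, Stacks.get, Stacks.set] using Runs.refl _)
  | cons x l ih =>
    refine .head ?_
    have := ih (fun h => hl (List.mem_cons_of_mem _ h))
    cases x <;> simp_all [program, Stacks.get, Stacks.set]

theorem runs_readInit (l rest : List CRPSymbol) (hl : .ket ∉ l) :
    Runs (cfg (some .readInit) f { s with input := l ++ .ket :: rest })
      (cfg (some .transfer) f { s with input := rest, fresh := l.reverse ++ s.fresh })
      (l.length + 1) := by
  induction l generalizing s with
  | nil => exact .head (by simpa [program, Stacks.get, Stacks.set] using Runs.refl _)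
  | cons x l ih =>
    refine .head ?_
    have := ih (fun h => hl (List.mem_cons_of_mem _ h)) (s := { s with fresh := x :: s.fresh })
    cases x <;> simp_all [program, Stacks.get, Stacks.set]

theorem runs_copyStep (l rest : List CRPSymbol) (hl : .ket ∉ l) :
    Runs (cfg (some .copyStep) f { s with input := l ++ .ket :: rest })
      (cfg (some .copySteps) f { s with
        input := rest
        stepsDone := .ket :: (l.reverse ++ s.stepsDone)
        counter := .ket :: (l.reverse ++ s.counter) }) (l.length + 1) := by
  induction l generalizing s with
  | nil => exact .head (by simpa [program, Stacks.get, Stacks.set] using Runs.refl _)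
  | cons x l ih =>
    refine .head ?_
    have := ih (fun h => hl (List.mem_cons_of_mem _ h))
      (s := { s with stepsDone := x :: s.stepsDone, counter := x :: s.counter })
    cases x <;> simp_all [program, Stacks.get, Stacks.set]

theorem bra_notMem_encodeNumber (a : ℕ) : .bra ∉ encodeNumber a := by
  simp [encodeNumber]

theorem ket_notMem_encodeNumber (a : ℕ) : .ket ∉ encodeNumber a := by
  simp [encodeNumber]

theorem ket_notMem_encodeEntries {n : ℕ} (L : StepList n) : .ket ∉ encodeEntries L := by
  simp [encodeEntries, encodeEntry, ket_notMem_encodeNumber]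

theorem runs_copySteps {n : ℕ} (steps : List (StepList n)) (rest : List CRPSymbol) :
    Runs (cfg (some .copySteps) f
        { s with input := steps.flatMap StepList.encode ++ .ket :: rest })
      (cfg (some .rewind) { f with phase := .steps } { s with
        input := rest
        stepsDone := (steps.flatMap StepList.encode).reverse ++ s.stepsDone
        counter := .ket :: ((steps.flatMap StepList.encode).reverse ++ s.counter) })
      ((steps.flatMap StepList.encode).length + 1) := by
  induction steps generalizing s with
  | nil => exact .head (by simpa [program, Stacks.get, Stacks.set] using Runs.refl _)
  | cons L steps ih =>
    have h₁ := runs_copyStep (f := f)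
      (s := { s with stepsDone := .bra :: s.stepsDone, counter := .bra :: s.counter })
      (encodeEntries L) (steps.flatMap StepList.encode ++ .ket :: rest)
      (ket_notMem_encodeEntries L)
    have h₂ := ih
      (s := { s with
        stepsDone := .ket :: ((encodeEntries L).reverse ++ .bra :: s.stepsDone)
        counter := .ket :: ((encodeEntries L).reverse ++ .bra :: s.counter) })
    have h := h₁.trans h₂
    refine Runs.mono (.head (t := ?t) ?run) ?le
    case run =>
      simpa [program, Stacks.get, Stacks.set, encode_stepList, -List.length_flatMap] using h
    case le =>
      simp only [List.flatMap_cons, encode_stepList, List.length_cons, List.length_append,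
        List.length_nil]
      omega

/-! ### Evaluating the constraint -/

/-- The constraint in prefix notation, with the values of its atoms. -/
def evalAtoms {n : ℕ} (K : KnownList n) : GeConstraint (Fin n) → List CRPSymbol
  | .geq q a => [.bit (decide ((true, q) ∈ K) || decide (a = 0))]
  | .and φ ψ => .and :: (evalAtoms K φ ++ evalAtoms K ψ)
  | .or φ ψ => .or :: (evalAtoms K φ ++ evalAtoms K ψ)

theorem length_evalAtoms_le {n : ℕ} (K : KnownList n) (φ : GeConstraint (Fin n)) :
    (evalAtoms K φ).length ≤ φ.encode.length := by
  induction φ with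
  | geq q a => simp [evalAtoms, GeConstraint.encode]
  | and φ ψ ih₁ ih₂ | or φ ψ ih₁ ih₂ =>
    simp only [evalAtoms, GeConstraint.encode, List.length_cons, List.length_append]
    omega

theorem runs_readFormula_digits (bs : List Bool) (acc rest : List CRPSymbol) :
    Runs (cfg (some .readFormula) f { s with input := bs.map .bit ++ .endNum :: rest, num := acc })
      (cfg (some .reverse) f { s with
        input := rest
        num := (bs.map .bit).reverse ++ acc }) (bs.length + 1) := by
  induction bs generalizing acc with
  | nil => exact .head (by simpa [program, Stacks.get, Stacks.set] using Runs.refl _)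
  | cons b bs ih =>
    refine .head ?_
    simpa [program, Stacks.get, Stacks.set] using ih (.bit b :: acc)

theorem runs_readBound (bs : List Bool) (rest : List CRPSymbol) {fd e ok pos : Bool}
    {ph : Phase} :
    Runs (cfg (some .readBound) ⟨fd, e, ok, pos, ph⟩
        { s with input := bs.map .bit ++ .endNum :: rest })
      (cfg (some .readFormula) ⟨false, e, ok, false, ph⟩ { s with
        input := rest
        formula := .bit (fd || !(pos || !bs.isEmpty)) :: s.formula }) (bs.length + 1) := by
  induction bs generalizing pos with
  | nil => exact .head (by simpa [program, Stacks.get, Stacks.set] using Runs.refl _)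
  | cons b bs ih =>
    refine .head ?_
    simpa [program, Stacks.get, Stacks.set] using ih (pos := true)

theorem runs_readFormula {n : ℕ} (K : KnownList n) (φ : GeConstraint (Fin n))
    (rest : List CRPSymbol) :
    Runs (cfg (some .readFormula) ⟨false, true, false, false, .formula⟩ { s with
          input := φ.encode ++ rest
          known := encodeKnown K, knownDone := [], num := [], numDone := [] })
      (cfg (some .readFormula) ⟨false, true, false, false, .formula⟩ { s with
          input := rest
          known := encodeKnown K, knownDone := [], num := [], numDone := []
          formula := (evalAtoms K φ).reverse ++ s.formula })
      (φ.encode.length * (3 * (encodeKnown K).length + 4)) := by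
  induction φ generalizing s rest with
  | geq q a =>
    have h₁ := runs_readFormula_digits (f := ⟨false, true, false, false, .formula⟩)
      (s := { s with known := encodeKnown K, knownDone := [], numDone := [] })
      (Computability.encodeNat q) [] (encodeNumber a ++ rest)
    have h₂ := runs_search (s := { s with input := encodeNumber a ++ rest })
      K q (ok := false) (pos := false) (ph := .formula)
    have h₃ := runs_readBound (fd := decide ((true, q) ∈ K)) (e := true) (ok := false)
      (pos := false) (ph := .formula)
      (s := { s with known := encodeKnown K, knownDone := [], num := [], numDone := [] })
      (Computability.encodeNat a) rest
    simp only [isEmpty_encodeNat, encodeNumber_eq, digits, List.append_assoc, List.cons_append,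
      List.nil_append, List.append_nil, Bool.false_or, Bool.not_not, if_true] at h₁ h₂ h₃
    have h := h₁.trans (h₂.trans h₃)
    refine Runs.mono (.head (t := ?t) ?run) ?le
    case run =>
      simpa [program, Stacks.get, Stacks.set, GeConstraint.encode, encodeNumber_eq, digits,
        evalAtoms] using h
    case le =>
      simp [GeConstraint.encode, encodeNumber_eq, digits]
      nlinarith
  | and φ ψ ih₁ ih₂ | or φ ψ ih₁ ih₂ =>
    have h (x : CRPSymbol) := (ih₁ (s := { s with formula := x :: s.formula })
      (ψ.encode ++ rest)).trans
      (ih₂ (s := { s with formula := (evalAtoms K φ).reverse ++ x :: s.formula }) rest)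
    refine Runs.mono (.head (t := φ.encode.length * (3 * (encodeKnown K).length + 4) +
      ψ.encode.length * (3 * (encodeKnown K).length + 4)) ?_) ?_
    · first
        | simpa [program, Stacks.get, Stacks.set, GeConstraint.encode, evalAtoms] using h .and
        | simpa [program, Stacks.get, Stacks.set, GeConstraint.encode, evalAtoms] using h .or
    · simp only [GeConstraint.encode, List.length_cons, List.length_append]
      nlinarith

/-- Since the string is read backwards, the operands precede their operator. -/
theorem runs_evaluate {n : ℕ} (K : KnownList n) (φ : GeConstraint (Fin n))
    (rest : List CRPSymbol) (hf : f.found = false) :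
    Runs (cfg (some .evaluate) f { s with formula := (evalAtoms K φ).reverse ++ rest })
      (cfg (some .evaluate) f
        { s with formula := rest, output := φ.evalKnown K :: s.output })
      (evalAtoms K φ).length := by
  have hf' : { f with found := false } = f := by rw [← hf]
  induction φ generalizing s rest with
  | geq q a =>
    exact .head (by
      simpa [program, Stacks.get, Stacks.set, evalAtoms, GeConstraint.evalKnown] using Runs.refl _)
  | and φ ψ ih₁ ih₂ | or φ ψ ih₁ ih₂ =>
    have h (x : CRPSymbol) := (ih₂ (s := s) ((evalAtoms K φ).reverse ++ x :: rest)).trans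
      (ih₁ (s := { s with output := ψ.evalKnown K :: s.output }) (x :: rest))
    simp only [evalAtoms, List.reverse_cons, List.reverse_append, List.append_assoc,
      List.cons_append, List.nil_append]
    refine Runs.mono (t := (evalAtoms K ψ).length + (evalAtoms K φ).length + (0 + 1)) ?_ ?_
    · first
        | refine (h .and).trans (.head ?_)
        | refine (h .or).trans (.head ?_)
      simpa [program, Stacks.get, Stacks.set, hf', GeConstraint.evalKnown] using Runs.refl _
    · simp only [List.length_cons, List.length_append]
      omega

/-! ### The complete computation -/

open Polynomial in
/-- The time bound. If `X` is the length of the input, then `X + X * X` bounds the length of the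
list of known states; the first summand is for the rounds, the second one for the constraint. -/
noncomputable def timeBound : Polynomial ℕ :=
  X * (X * (3 * (X + X * X) + 5) + 2) + X * (3 * (X + X * X) + 5) + (X + X * X) + 6 * X + 10

theorem encodeKnown_initKnown (I : CRPInstance) :
    encodeKnown I.initKnown = I.init.flatMap fun q => encodeNumber q.val := by
  simp [encodeKnown, CRPInstance.initKnown, List.flatMap_map, encodeNumber_eq, mark]

theorem length_encode (I : CRPInstance) :
    I.encode.length = (encodeNumber I.n).length + (encodeKnown I.initKnown).length +
      I.stepsString.length + I.φ.encode.length + 4 := by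
  simp only [CRPInstance.encode, ← encodeKnown_initKnown, List.length_append, List.length_cons,
    List.length_nil]
  rw [CRPInstance.stepsString]
  omega

theorem length_encodeKnown_known_le (I : CRPInstance) :
    (encodeKnown I.known).length ≤ I.encode.length + I.encode.length * I.encode.length := by
  have h := length_encodeKnown_iterate_round_le I.steps I.initKnown (I.stepsString.length + 1)
  have h' := length_encode I
  refine h.trans (Nat.add_le_add (by omega) (Nat.mul_le_mul (by omega) ?_))
  change I.stepsString.length ≤ _
  omega

theorem runs_program (I : CRPInstance) :
    Runs (cfg (some .skipSize) {} { input := I.encode }) (cfg none {} { output := [I.decideCRP] })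
      (timeBound.eval I.encode.length) := by
  have hlen := length_encode I
  have hM := length_encodeKnown_known_le I
  set N := I.encode.length with hN
  set M := N + N * N with hMN
  have h₁ := runs_skipSize (f := {}) (s := {}) (encodeNumber I.n)
    (encodeKnown I.initKnown ++ .ket :: .bra :: (I.stepsString ++ .ket :: I.φ.encode))
    (bra_notMem_encodeNumber _)
  have h₂ := runs_readInit (f := {}) (s := {}) (encodeKnown I.initKnown)
    (.bra :: (I.stepsString ++ .ket :: I.φ.encode))
    (by simp [encodeKnown_initKnown, ket_notMem_encodeNumber])
  have h₃ := runs_transfer (f := {})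
    (s := { input := .bra :: (I.stepsString ++ .ket :: I.φ.encode) })
    (encodeKnown I.initKnown).reverse
  have h₄ := runs_copySteps (f := {}) (s := { known := encodeKnown I.initKnown }) I.steps
    I.φ.encode
  have hknown : (KnownList.round I.steps)^[(CRPSymbol.ket :: I.stepsString.reverse).length]
      I.initKnown = I.known := by
    simp [CRPInstance.known]
  have h₅ := runs_rounds (s := { input := I.φ.encode }) I.steps I.initKnown
    (.ket :: I.stepsString.reverse) (M := M) (by rwa [hknown])
  have h₆ := runs_readFormula (s := { steps := I.stepsString }) I.known I.φ []
  have h₇ := runs_evaluate (f := ⟨false, true, false, false, .formula⟩)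
    (s := { steps := I.stepsString, known := encodeKnown I.known }) I.known I.φ [] rfl
  have h₈ := runs_cleanSteps (f := ⟨false, true, false, false, .formula⟩)
    (s := { known := encodeKnown I.known, output := [I.decideCRP] }) I.stepsString
  have h₉ := runs_cleanKnown (f := ⟨false, true, false, false, .formula⟩)
    (s := { output := [I.decideCRP] }) (encodeKnown I.known)
  have hatoms := length_evalAtoms_le I.known I.φ
  have e₁ : I.encode = encodeNumber I.n ++
      .bra :: (encodeKnown I.initKnown ++ .ket :: .bra ::
        (I.stepsString ++ .ket :: I.φ.encode)) := by
    simp [CRPInstance.encode, encodeKnown_initKnown, CRPInstance.stepsString]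
  have h₃₄ : Runs
      (cfg (some .transfer) {} {
        input := .bra :: (I.stepsString ++ .ket :: I.φ.encode)
        known := encodeKnown I.initKnown })
      (cfg (some .copySteps) {} {
        input := I.stepsString ++ .ket :: I.φ.encode
        known := encodeKnown I.initKnown }) (0 + 1) :=
    .head (by simpa [program, Stacks.get, Stacks.set] using Runs.refl _)
  have h₆₇ : Runs
      (cfg (some .readFormula) ⟨false, true, false, false, .formula⟩ {
        steps := I.stepsString
        known := encodeKnown I.known
        formula := (evalAtoms I.known I.φ).reverse })
      (cfg (some .evaluate) ⟨false, true, false, false, .formula⟩ {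
        steps := I.stepsString
        known := encodeKnown I.known
        formula := (evalAtoms I.known I.φ).reverse }) (0 + 1) :=
    .head (by simpa [program, Stacks.get, Stacks.set] using Runs.refl _)
  have h₇₈ : Runs
      (cfg (some .evaluate) ⟨false, true, false, false, .formula⟩ {
        steps := I.stepsString
        known := encodeKnown I.known
        output := [I.decideCRP] })
      (cfg (some .cleanSteps) ⟨false, true, false, false, .formula⟩ {
        steps := I.stepsString
        known := encodeKnown I.known
        output := [I.decideCRP] }) (0 + 1) :=
    .head (by simpa [program, Stacks.get, Stacks.set] using Runs.refl _)
  rw [hknown] at h₅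
  simp only [List.append_nil, List.reverse_reverse] at h₂ h₃ h₄ h₆ h₇
  rw [e₁]
  refine Runs.mono (h₁.trans <| h₂.trans <| h₃.trans <| h₃₄.trans <| h₄.trans <| h₅.trans <|
    h₆.trans <| h₆₇.trans <| h₇.trans <| h₇₈.trans <| h₈.trans h₉) ?_
  -- The same string has to be called `I.stepsString` everywhere before `omega` can be used.
  change _ + (_ + (_ + (_ + (I.stepsString.length + 1 +
    ((_ + 1) * (I.stepsString.length * _ + 2) + _))))) ≤ _
  simp only [timeBound, Polynomial.eval_add, Polynomial.eval_mul, Polynomial.eval_X,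
    Polynomial.eval_ofNat, List.length_reverse, List.length_cons]
  rw [← hMN]
  have b₁ : (I.stepsString.length + 1 + 1) * (I.stepsString.length * (3 * M + 5) + 2) ≤
      N * (N * (3 * M + 5) + 2) := by
    gcongr <;> omega
  have b₂ : I.φ.encode.length * (3 * (encodeKnown I.known).length + 4) ≤ N * (3 * M + 5) := by
    gcongr <;> omega
  omega

theorem initList_machine (l : List CRPSymbol) :
    Turing.initList machine l = cfg (some .skipSize) {} { input := l } := by
  refine congrArg (Turing.TM2.Cfg.mk _ _) (funext fun k => ?_)
  rcases k with _ | (_ | _) <;> rfl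

theorem haltList_machine (l : List Bool) :
    Turing.haltList machine l = cfg none {} { output := l } := by
  refine congrArg (Turing.TM2.Cfg.mk _ _) (funext fun k => ?_)
  rcases k with _ | (_ | _) <;> rfl

/-- The machine computes `decideCRP` in polynomial time. -/
noncomputable def computableInPolyTime :
    Turing.TM2ComputableInPolyTime CRPInstance.encode Computability.encodeBool
      CRPInstance.decideCRP where
  tm := machine
  inputAlphabet := Equiv.refl CRPSymbol
  outputAlphabet := Equiv.refl Bool
  time := timeBound
  outputsFun I := by
    have hin : Turing.initList machine (I.encode.map (Equiv.refl CRPSymbol).invFun) =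
        cfg (some .skipSize) {} { input := I.encode } :=
      (initList_machine _).trans
        (congrArg (fun l => cfg (some .skipSize) {} { input := l }) (List.map_id I.encode))
    have hout : Turing.haltList machine
          ((Computability.encodeBool I.decideCRP).map (Equiv.refl Bool).invFun) =
        cfg none {} { output := [I.decideCRP] } :=
      haltList_machine _
    have h := runs_program I
    exact
      { steps := h.choose
        evals_in_steps := by
          rw [hin, Option.map_some, hout]
          exact h.choose_spec.2
        steps_le_m := h.choose_spec.1 }

end CRPMachine

theorem mainTheorem9 :
    ∃ decideCRP : CRPInstance → Bool,
      Nonempty (Turing.TM2ComputableInPolyTime CRPInstance.encode Computability.encodeBool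
        decideCRP) ∧
      ∀ (I : CRPInstance) (S : TransitionCounterSystem (Fin I.n)),
        S.toCounterSystem.FullyCompatible ConfigLe₀ → I.Describes S →
          (decideCRP I = true ↔ S.toCounterSystem.CRP I.φ) ∧
          (∃ s, S.IsSaturation s) ∧
          ∀ s, S.IsSaturation s →
            (decideCRP I = true ↔ I.φ.abstr.Sat (fun q => (s q).toNat)) := by
  refine ⟨CRPInstance.decideCRP, ⟨CRPMachine.computableInPolyTime⟩, fun I S hS hI => ?_⟩
  obtain ⟨s, hs⟩ := S.exists_isSaturation
  exact ⟨(hI.decideCRP_iff hs).trans (hs.crp_iff hS I.φ).symm, ⟨s, hs⟩,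
    fun s hs => hI.decideCRP_iff hs⟩
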